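/- Let $M$ be a finite-dimensional smooth manifold (Hausdorff, second countable, without boundary), let $f\in C^\infty(M)$ and let $\theta\in\Omega^1(M)$ be a closed $1$-form. For $\varphi\in\Omega^r(M)$ put $$d_f\varphi=f\,d\varphi-r\,df\wedge\varphi,\qquad d_{f,\theta}\varphi=d_f\varphi-f\theta\wedge\varphi .$$ Since $d\theta=0$, one has $d_{f,\theta}^2=0$. Let $H^r_{f,\theta}(M)$, $r\ge 0$, denote the cohomology groups of the complex $0\to\Omega^0(M)\xrightarrow{d_{f,\theta}}\Omega^1(M)\xrightarrow{d_{f,\theta}}\cdots$, and use the same notation for open subsets of $M$ with the restrictions of $f$ and $\theta$. **Theorem 2.1.** Let $\{U,V\}$ be an open cover of $M$. There are linear maps $\delta$ such that the sequence $$0\to H^0_{f,\theta}(M)\to\cdots\to H^{r}_{f,\theta}(M)\xrightarrow{\alpha_*}H^{r}_{f|_U,\theta|_U}(U)\oplus H^{r}_{f|_V,\theta|_V}(V)\xrightarrow{\beta_*}H^{r}_{f|_{U\cap V},\theta|_{U\cap V}}(U\cap V)\xrightarrow{\delta}H^{r+1}_{f,\theta}(M)\xrightarrow{\alpha_*}\cdots$$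 is exact, where $$\alpha_*([\varphi])=([\varphi|_U],[\varphi|_V]),\qquad \beta_*([\varphi],[\psi])=[\varphi|_{U\cap V}-\psi|_{U\cap V}],$$ and where, for every smooth partition of unity $\{\lambda_U,\lambda_V\}$ subordinate to $\{U,V\}$ and every $\sigma\in\Omega^r(U\cap V)$ that is closed for the operator $d_{f|_{U\cap V},\theta|_{U\cap V}}$, $$\delta([\sigma])=[d_f\lambda_V\wedge\sigma]=-[d_f\lambda_U\wedge\sigma].$$ Here the forms $d_f\lambda_V\wedge\sigma$ and $d_f\lambda_U\wedge\sigma$ on $U\cap V$ are extended by $0$ to the whole of $M$, and these extensions are smooth and $d_{f,\theta}$-closed. -/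

import Mathlib

open scoped Manifold ContDiff Topology Bundle

noncomputable section

namespace LichCoh

/-! ### Smooth dependence of `a ∘ A` on the alternating form `a` and the linear map `A` -/

section Multilinear

variable {E F : Type*} [NormedAddCommGroup E] [NormedSpace ℝ E]
  [NormedAddCommGroup F] [NormedSpace ℝ F]

/-- The continuous linear projection of multilinear forms onto alternating forms. -/
def altProj (E : Type*) [NormedAddCommGroup E] [NormedSpace ℝ E] (r : ℕ) :
    ContinuousMultilinearMap ℝ (fun _ : Fin r => E) ℝ →L[ℝ] E [⋀^Fin r]→L[ℝ] ℝ where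
  toFun f := (r.factorial : ℝ)⁻¹ • ContinuousMultilinearMap.alternatization f
  map_add' f g := by simp
  map_smul' c f := by
    ext v
    simp [ContinuousMultilinearMap.alternatization_apply_apply, Finset.mul_sum]
    refine Finset.sum_congr rfl fun σ _ => ?_
    rcases Int.units_eq_one_or (Equiv.Perm.sign σ) with h | h <;> simp [h] <;> ring
  cont := by
    rw [ContinuousAlternatingMap.isEmbedding_toContinuousMultilinearMap.continuous_iff]
    have : (fun f : ContinuousMultilinearMap ℝ (fun _ : Fin r => E) ℝ =>
        ((r.factorial : ℝ)⁻¹ • ContinuousMultilinearMap.alternatization f).toContinuousMultilinearMap)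
        = fun f => (r.factorial : ℝ)⁻¹ • ∑ σ : Equiv.Perm (Fin r),
          Equiv.Perm.sign σ • (ContinuousMultilinearMap.domDomCongrₗᵢ ℝ E ℝ σ f) := by
      funext f
      ext v
      simp only [ContinuousAlternatingMap.coe_toContinuousMultilinearMap,
        ContinuousAlternatingMap.smul_apply, _root_.smul_apply,
        _root_.sum_apply,
        ContinuousMultilinearMap.alternatization_apply_apply]
      rfl
    change Continuous (fun f : ContinuousMultilinearMap ℝ (fun _ : Fin r => E) ℝ =>
        ((r.factorial : ℝ)⁻¹ • ContinuousMultilinearMap.alternatization f).toContinuousMultilinearMap)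
    rw [this]
    fun_prop

theorem altProj_apply {r : ℕ} (a : E [⋀^Fin r]→L[ℝ] ℝ) :
    altProj E r a.toContinuousMultilinearMap = a := by
  ext v
  have h0 : (r.factorial : ℝ) ≠ 0 := by exact_mod_cast r.factorial_ne_zero
  have h : ∀ σ : Equiv.Perm (Fin r), Equiv.Perm.sign σ • a (v ∘ σ) = a v := by
    intro σ
    have := a.toAlternatingMap.map_perm v σ
    simp only [ContinuousAlternatingMap.coe_toAlternatingMap] at this
    rw [this, smul_smul]
    simp
  change (r.factorial : ℝ)⁻¹ • ContinuousMultilinearMap.alternatization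
    a.toContinuousMultilinearMap v = a v
  rw [ContinuousMultilinearMap.alternatization_apply_apply]
  change (r.factorial : ℝ)⁻¹ • (∑ σ : Equiv.Perm (Fin r), Equiv.Perm.sign σ • a (v ∘ σ)) = a v
  simp only [h]
  simp [Fintype.card_perm, h0]

theorem contDiff_compContinuousLinearMap {r : ℕ} :
    ContDiff ℝ ∞ (fun p : (F [⋀^Fin r]→L[ℝ] ℝ) × (E →L[ℝ] F) => p.1.compContinuousLinearMap p.2) := by
  have h : (fun p : (F [⋀^Fin r]→L[ℝ] ℝ) × (E →L[ℝ] F) => p.1.compContinuousLinearMap p.2)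
      = fun p => altProj E r (ContinuousMultilinearMap.compContinuousLinearMapContinuousMultilinear
          ℝ (fun _ : Fin r => E) (fun _ : Fin r => F) ℝ (fun _ => p.2)
          (ContinuousAlternatingMap.toContinuousMultilinearMapCLM ℝ p.1)) := by
    funext p
    rw [← altProj_apply (p.1.compContinuousLinearMap p.2)]
    rfl
  rw [h]
  refine (altProj E r).contDiff.comp (ContDiff.clm_apply ?_ ?_)
  · exact (ContinuousMultilinearMap.contDiff _).comp (contDiff_pi.2 fun _ => contDiff_snd)
  · exact (ContinuousLinearMap.contDiff _).comp contDiff_fst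

end Multilinear

/-! ### Differential forms, pullback and exterior derivative -/

section Forms

variable {E : Type*} [NormedAddCommGroup E] [NormedSpace ℝ E]

/-- The fibre `Λʳ T*ₓM` of the bundle of alternating `r`-linear forms on the tangent spaces. -/
abbrev AltFiber (E : Type*) [NormedAddCommGroup E] [NormedSpace ℝ E]
    (M : Type*) [TopologicalSpace M] [ChartedSpace E M] (r : ℕ) (x : M) : Type _ :=
  (TangentSpace 𝓘(ℝ, E) x) [⋀^Fin r]→L[ℝ] (Bundle.Trivial M ℝ x)

/-- `Ωʳ(M)`: the smooth differential `r`-forms on the manifold `M`, as smooth sections of Mathlib's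
bundle of continuous alternating maps on the tangent bundle. -/
abbrev DiffForm (E : Type*) [NormedAddCommGroup E] [NormedSpace ℝ E]
    (M : Type*) [TopologicalSpace M] [ChartedSpace E M] [IsManifold 𝓘(ℝ, E) ∞ M] (r : ℕ) :=
  ContMDiffSection 𝓘(ℝ, E) (E [⋀^Fin r]→L[ℝ] ℝ) ∞ (AltFiber E M r)

variable {M : Type*} [TopologicalSpace M] [ChartedSpace E M]
  {N : Type*} [TopologicalSpace N] [ChartedSpace E N] {r : ℕ}

/-- Pullback `(g^* s)ₓ = s_{g x} ∘ (dgₓ × ⋯ × dgₓ)`. -/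
def pullbackFun (g : N → M) (s : ∀ x : M, AltFiber E M r x) : ∀ x : N, AltFiber E N r x :=
  fun x => ContinuousAlternatingMap.compContinuousLinearMap (s (g x))
    (mfderiv 𝓘(ℝ, E) 𝓘(ℝ, E) g x)

/-- The form `s` in the chart at `x₀`, i.e. its pullback by the inverse of the chart, as a form on
the model vector space (meaningful on the target of the chart). -/
def rep (x₀ : M) (s : ∀ x : M, AltFiber E M r x) : E → E [⋀^Fin r]→L[ℝ] ℝ :=
  pullbackFun (extChartAt 𝓘(ℝ, E) x₀).symm s

/-- The exterior derivative: at `x`, write the form in the chart at `x`, apply the exterior derivative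
of the model vector space, and pull back by the chart. The value is the same in every chart around
`x`, see `rep_extDFun`. -/
def extDFun (s : ∀ x : M, AltFiber E M r x) : ∀ x : M, AltFiber E M (r + 1) x :=
  fun x => ContinuousAlternatingMap.compContinuousLinearMap
    (extDeriv (rep x s) (extChartAt 𝓘(ℝ, E) x x))
    (mfderiv 𝓘(ℝ, E) 𝓘(ℝ, E) (extChartAt 𝓘(ℝ, E) x) x)

theorem target_nhds {x₀ : M} {y : E} (hy : y ∈ (extChartAt 𝓘(ℝ, E) x₀).target) :
    (extChartAt 𝓘(ℝ, E) x₀).target ∈ 𝓝 y :=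
  (isOpen_extChartAt_target x₀).mem_nhds hy

theorem source_nhds {x₀ x : M} (hx : x ∈ (extChartAt 𝓘(ℝ, E) x₀).source) :
    (extChartAt 𝓘(ℝ, E) x₀).source ∈ 𝓝 x :=
  (isOpen_extChartAt_source x₀).mem_nhds hx

theorem pullbackFun_id (s : ∀ x : M, AltFiber E M r x) : pullbackFun (fun x : M => x) s = s := by
  funext x
  unfold pullbackFun
  have : mfderiv 𝓘(ℝ, E) 𝓘(ℝ, E) (fun x : M => x) x = ContinuousLinearMap.id ℝ _ := mfderiv_id
  rw [this]
  ext v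
  simp

variable [IsManifold 𝓘(ℝ, E) ∞ M] [IsManifold 𝓘(ℝ, E) ∞ N]

theorem mdiff_chart {x₀ x : M} (hx : x ∈ (chartAt E x₀).source) :
    MDifferentiableAt 𝓘(ℝ, E) 𝓘(ℝ, E) (extChartAt 𝓘(ℝ, E) x₀) x :=
  mdifferentiableAt_extChartAt hx

theorem mdiff_symm {x₀ : M} {y : E} (hy : y ∈ (extChartAt 𝓘(ℝ, E) x₀).target) :
    MDifferentiableAt 𝓘(ℝ, E) 𝓘(ℝ, E) (extChartAt 𝓘(ℝ, E) x₀).symm y := by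
  have := mdifferentiableWithinAt_extChartAt_symm (I := 𝓘(ℝ, E)) hy
  rwa [show Set.range 𝓘(ℝ, E) = Set.univ by simp, mdifferentiableWithinAt_univ] at this

/-- Smoothness of a form at a point, read in the chart at that point. -/
theorem contMDiffAt_form_iff (s : ∀ x : M, AltFiber E M r x) (x₀ : M) :
    ContMDiffAt 𝓘(ℝ, E) (𝓘(ℝ, E).prod 𝓘(ℝ, E [⋀^Fin r]→L[ℝ] ℝ)) ∞
      (fun x => Bundle.TotalSpace.mk' (E [⋀^Fin r]→L[ℝ] ℝ) x (s x)) x₀ ↔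
    ContDiffAt ℝ ∞ (rep x₀ s) (extChartAt 𝓘(ℝ, E) x₀ x₀) := by
  rw [Bundle.contMDiffAt_section, contMDiffAt_iff_source]
  rw [show Set.range 𝓘(ℝ, E) = Set.univ by simp, contMDiffWithinAt_univ, contMDiffAt_iff_contDiffAt]
  suffices main : (fun x => (trivializationAt (E [⋀^Fin r]→L[ℝ] ℝ) (AltFiber E M r) x₀
      ⟨x, s x⟩).2) ∘ (extChartAt 𝓘(ℝ, E) x₀).symm =ᶠ[𝓝 (extChartAt 𝓘(ℝ, E) x₀ x₀)] rep x₀ s by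
    exact ⟨fun h => h.congr_of_eventuallyEq main.symm, fun h => h.congr_of_eventuallyEq main⟩
  filter_upwards [target_nhds (mem_extChartAt_target (I := 𝓘(ℝ, E)) x₀)] with y hy
  have hs : (extChartAt 𝓘(ℝ, E) x₀).symm y ∈ (chartAt E x₀).source := by
    rw [← extChartAt_source 𝓘(ℝ, E)]; exact (extChartAt 𝓘(ℝ, E) x₀).map_target hy
  have := TangentBundle.symmL_trivializationAt (𝕜 := ℝ) (I := 𝓘(ℝ, E)) hs
  rw [show Set.range 𝓘(ℝ, E) = Set.univ by simp, mfderivWithin_univ,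
    (extChartAt 𝓘(ℝ, E) x₀).right_inv hy] at this
  simp only [Function.comp_apply]
  rw [FiberBundle.trivializationAt_continuousAlternatingMap_apply]
  simp only [ContinuousAlternatingMap.inCoordinates]
  rw [this]
  ext v
  simp [rep, pullbackFun]
  rfl

/-- The expression of a pullback in charts. -/
theorem rep_pullback (g : N → M) (s : ∀ x : M, AltFiber E M r x) (y₀ : N) (x₀ : M) {z : E}
    (hz : z ∈ (extChartAt 𝓘(ℝ, E) y₀).target)
    (hg : MDifferentiableAt 𝓘(ℝ, E) 𝓘(ℝ, E) g ((extChartAt 𝓘(ℝ, E) y₀).symm z))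
    (hx : g ((extChartAt 𝓘(ℝ, E) y₀).symm z) ∈ (extChartAt 𝓘(ℝ, E) x₀).source) :
    rep y₀ (pullbackFun g s) z =
      (rep x₀ s (extChartAt 𝓘(ℝ, E) x₀ (g ((extChartAt 𝓘(ℝ, E) y₀).symm z)))).compContinuousLinearMap
        (fderiv ℝ (fun z => extChartAt 𝓘(ℝ, E) x₀ (g ((extChartAt 𝓘(ℝ, E) y₀).symm z))) z) := by
  set ψ := (extChartAt 𝓘(ℝ, E) y₀).symm with hψ
  set φ := extChartAt 𝓘(ℝ, E) x₀ with hφ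
  have h1 : MDifferentiableAt 𝓘(ℝ, E) 𝓘(ℝ, E) ψ z := mdiff_symm hz
  have hgψ : MDifferentiableAt 𝓘(ℝ, E) 𝓘(ℝ, E) (g ∘ ψ) z := hg.comp z h1
  have hφ1 : MDifferentiableAt 𝓘(ℝ, E) 𝓘(ℝ, E) φ (g (ψ z)) :=
    mdiff_chart (by rw [← extChartAt_source 𝓘(ℝ, E)]; exact hx)
  have hG : MDifferentiableAt 𝓘(ℝ, E) 𝓘(ℝ, E) (φ ∘ (g ∘ ψ)) z := hφ1.comp z hgψ
  have hy : φ (g (ψ z)) ∈ φ.target := φ.map_source hx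
  have hinv : φ.symm (φ (g (ψ z))) = g (ψ z) := φ.left_inv hx
  have hev : φ.symm ∘ (φ ∘ (g ∘ ψ)) =ᶠ[𝓝 z] g ∘ ψ := by
    filter_upwards [hgψ.continuousAt (source_nhds (x₀ := x₀) hx)] with w hw
    exact φ.left_inv hw
  have key : (mfderiv 𝓘(ℝ, E) 𝓘(ℝ, E) φ.symm (φ (g (ψ z)))).comp
      (mfderiv 𝓘(ℝ, E) 𝓘(ℝ, E) (φ ∘ (g ∘ ψ)) z) =
      (mfderiv 𝓘(ℝ, E) 𝓘(ℝ, E) g (ψ z)).comp (mfderiv 𝓘(ℝ, E) 𝓘(ℝ, E) ψ z) := by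
    have a := mfderiv_comp z (mdiff_symm hy) hG
    have b := mfderiv_comp z hg h1
    have c := hev.mfderiv_eq (I := 𝓘(ℝ, E)) (I' := 𝓘(ℝ, E))
    refine a.symm.trans (Eq.trans ?_ b)
    exact c
  rw [mfderiv_eq_fderiv] at key
  have aux : ∀ (p q : M) (_ : p = q) (A B : E →L[ℝ] E), A = B →
      ContinuousAlternatingMap.compContinuousLinearMap
        (show E [⋀^Fin r]→L[ℝ] ℝ from s p) A =
      ContinuousAlternatingMap.compContinuousLinearMap
        (show E [⋀^Fin r]→L[ℝ] ℝ from s q) B := by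
    rintro p q rfl A B rfl; rfl
  exact (aux _ _ hinv _ _ key).symm


/-- The coordinate expression of a smooth map is smooth. -/
theorem coord_contDiffAt {g : N → M} (y₀ : N) (x₀ : M) {z : E}
    (hz : z ∈ (extChartAt 𝓘(ℝ, E) y₀).target)
    (hg : ContMDiffAt 𝓘(ℝ, E) 𝓘(ℝ, E) ∞ g ((extChartAt 𝓘(ℝ, E) y₀).symm z))
    (hx : g ((extChartAt 𝓘(ℝ, E) y₀).symm z) ∈ (extChartAt 𝓘(ℝ, E) x₀).source) :
    ContDiffAt ℝ ∞
      (fun z => extChartAt 𝓘(ℝ, E) x₀ (g ((extChartAt 𝓘(ℝ, E) y₀).symm z))) z := by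
  rw [← contMDiffAt_iff_contDiffAt]
  have h1 : ContMDiffAt 𝓘(ℝ, E) 𝓘(ℝ, E) ∞ (extChartAt 𝓘(ℝ, E) y₀).symm z :=
    (contMDiffOn_extChartAt_symm y₀).contMDiffAt (target_nhds hz)
  have h2 : ContMDiffAt 𝓘(ℝ, E) 𝓘(ℝ, E) ∞ (extChartAt 𝓘(ℝ, E) x₀)
      (g ((extChartAt 𝓘(ℝ, E) y₀).symm z)) :=
    contMDiffAt_extChartAt' (by rwa [← extChartAt_source 𝓘(ℝ, E)])
  exact h2.comp z (hg.comp z h1)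

theorem eventually_coord {g : N → M} (y₀ : N) (x₀ : M) {z : E}
    (hz : z ∈ (extChartAt 𝓘(ℝ, E) y₀).target)
    (hg : ContMDiffAt 𝓘(ℝ, E) 𝓘(ℝ, E) ∞ g ((extChartAt 𝓘(ℝ, E) y₀).symm z))
    (hx : g ((extChartAt 𝓘(ℝ, E) y₀).symm z) ∈ (extChartAt 𝓘(ℝ, E) x₀).source) :
    ∀ᶠ w in 𝓝 z, w ∈ (extChartAt 𝓘(ℝ, E) y₀).target ∧
      g ((extChartAt 𝓘(ℝ, E) y₀).symm w) ∈ (extChartAt 𝓘(ℝ, E) x₀).source := by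
  refine Filter.Eventually.and (target_nhds hz) ?_
  have h1 : ContMDiffAt 𝓘(ℝ, E) 𝓘(ℝ, E) ∞ (extChartAt 𝓘(ℝ, E) y₀).symm z :=
    (contMDiffOn_extChartAt_symm y₀).contMDiffAt (target_nhds hz)
  exact (hg.comp z h1).continuousAt (source_nhds hx)

theorem rep_pullback_eventually {g : N → M} (hg : ContMDiff 𝓘(ℝ, E) 𝓘(ℝ, E) ∞ g)
    (s : ∀ x : M, AltFiber E M r x) (y₀ : N) (x₀ : M) {z : E}
    (hz : z ∈ (extChartAt 𝓘(ℝ, E) y₀).target)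
    (hx : g ((extChartAt 𝓘(ℝ, E) y₀).symm z) ∈ (extChartAt 𝓘(ℝ, E) x₀).source) :
    rep y₀ (pullbackFun g s) =ᶠ[𝓝 z] fun z =>
      (rep x₀ s (extChartAt 𝓘(ℝ, E) x₀ (g ((extChartAt 𝓘(ℝ, E) y₀).symm z)))).compContinuousLinearMap
        (fderiv ℝ (fun z => extChartAt 𝓘(ℝ, E) x₀ (g ((extChartAt 𝓘(ℝ, E) y₀).symm z))) z) := by
  filter_upwards [eventually_coord y₀ x₀ hz (hg _) hx] with w hw
  exact rep_pullback g s y₀ x₀ hw.1 ((hg _).mdifferentiableAt (by simp)) hw.2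

/-- Smoothness of a section of the bundle of alternating maps. -/
def IsSmoothForm (s : ∀ x : M, AltFiber E M r x) : Prop :=
  ContMDiff 𝓘(ℝ, E) (𝓘(ℝ, E).prod 𝓘(ℝ, E [⋀^Fin r]→L[ℝ] ℝ)) ∞
      (fun x => Bundle.TotalSpace.mk' (E [⋀^Fin r]→L[ℝ] ℝ) x (s x))

theorem rep_pullback_contDiffAt {g : N → M} (hg : ContMDiff 𝓘(ℝ, E) 𝓘(ℝ, E) ∞ g)
    {s : ∀ x : M, AltFiber E M r x} (hs : IsSmoothForm s) (y₀ : N) {z : E}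
    (hz : z ∈ (extChartAt 𝓘(ℝ, E) y₀).target) :
    ContDiffAt ℝ ∞ (rep y₀ (pullbackFun g s)) z := by
  set x₀ := g ((extChartAt 𝓘(ℝ, E) y₀).symm z) with hx₀
  have hx : g ((extChartAt 𝓘(ℝ, E) y₀).symm z) ∈ (extChartAt 𝓘(ℝ, E) x₀).source :=
    mem_extChartAt_source _
  have hG := coord_contDiffAt y₀ x₀ hz (hg _) hx
  have hr : ContDiffAt ℝ ∞ (rep x₀ s)
      (extChartAt 𝓘(ℝ, E) x₀ (g ((extChartAt 𝓘(ℝ, E) y₀).symm z))) :=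
    (contMDiffAt_form_iff s x₀).1 (hs x₀)
  refine ContDiffAt.congr_of_eventuallyEq ?_ (rep_pullback_eventually hg s y₀ x₀ hz hx)
  exact contDiff_compContinuousLinearMap.contDiffAt.comp z
    ((hr.comp z hG).prodMk (hG.fderiv_right (m := ∞) (by simp)))

theorem rep_contDiffAt {s : ∀ x : M, AltFiber E M r x} (hs : IsSmoothForm s) (x₀ : M) {z : E}
    (hz : z ∈ (extChartAt 𝓘(ℝ, E) x₀).target) : ContDiffAt ℝ ∞ (rep x₀ s) z := by
  have := rep_pullback_contDiffAt (contMDiff_id (M := M)) hs x₀ hz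
  rwa [show pullbackFun id s = s from pullbackFun_id s] at this

theorem isSmoothForm_pullback {g : N → M} (hg : ContMDiff 𝓘(ℝ, E) 𝓘(ℝ, E) ∞ g)
    {s : ∀ x : M, AltFiber E M r x} (hs : IsSmoothForm s) : IsSmoothForm (pullbackFun g s) :=
  fun y₀ => (contMDiffAt_form_iff _ y₀).2
    (rep_pullback_contDiffAt hg hs y₀ (mem_extChartAt_target y₀))

theorem extDeriv_rep_pullback {g : N → M} (hg : ContMDiff 𝓘(ℝ, E) 𝓘(ℝ, E) ∞ g)
    {s : ∀ x : M, AltFiber E M r x} (hs : IsSmoothForm s) (y₀ : N) (x₀ : M) {z : E}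
    (hz : z ∈ (extChartAt 𝓘(ℝ, E) y₀).target)
    (hx : g ((extChartAt 𝓘(ℝ, E) y₀).symm z) ∈ (extChartAt 𝓘(ℝ, E) x₀).source) :
    extDeriv (rep y₀ (pullbackFun g s)) z =
      (extDeriv (rep x₀ s)
        (extChartAt 𝓘(ℝ, E) x₀ (g ((extChartAt 𝓘(ℝ, E) y₀).symm z)))).compContinuousLinearMap
        (fderiv ℝ (fun z => extChartAt 𝓘(ℝ, E) x₀ (g ((extChartAt 𝓘(ℝ, E) y₀).symm z))) z) := by
  rw [(rep_pullback_eventually hg s y₀ x₀ hz hx).extDeriv_eq]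
  have hG := coord_contDiffAt y₀ x₀ hz (hg _) hx
  have hr := rep_contDiffAt hs x₀ ((extChartAt 𝓘(ℝ, E) x₀).map_source hx)
  exact extDeriv_pullback (hr.differentiableAt (by simp)) hG
    (by rw [minSmoothness_of_isRCLikeNormedField]; exact WithTop.coe_le_coe.2 le_top)

/-- In every chart, the exterior derivative is the one of the model vector space. -/
theorem rep_extDFun {s : ∀ x : M, AltFiber E M r x} (hs : IsSmoothForm s) (x₀ : M) {z : E}
    (hz : z ∈ (extChartAt 𝓘(ℝ, E) x₀).target) :
    rep x₀ (extDFun s) z = extDeriv (rep x₀ s) z := by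
  set p := (extChartAt 𝓘(ℝ, E) x₀).symm z with hp
  have hx : id ((extChartAt 𝓘(ℝ, E) x₀).symm z) ∈ (extChartAt 𝓘(ℝ, E) p).source :=
    mem_extChartAt_source _
  have h := extDeriv_rep_pullback (contMDiff_id (M := M)) hs x₀ p hz hx
  rw [show pullbackFun id s = s from pullbackFun_id s] at h
  rw [h]
  have hd : mfderiv 𝓘(ℝ, E) 𝓘(ℝ, E) (extChartAt 𝓘(ℝ, E) p ∘ (extChartAt 𝓘(ℝ, E) x₀).symm) z =
      (mfderiv 𝓘(ℝ, E) 𝓘(ℝ, E) (extChartAt 𝓘(ℝ, E) p) p).comp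
        (mfderiv 𝓘(ℝ, E) 𝓘(ℝ, E) (extChartAt 𝓘(ℝ, E) x₀).symm z) :=
    mfderiv_comp z (mdiff_chart (mem_chart_source E p)) (mdiff_symm hz)
  rw [mfderiv_eq_fderiv] at hd
  have aux : ∀ A B : E →L[ℝ] E, A = B →
      (extDeriv (rep p s) (extChartAt 𝓘(ℝ, E) p p)).compContinuousLinearMap A =
      (extDeriv (rep p s) (extChartAt 𝓘(ℝ, E) p p)).compContinuousLinearMap B := by
    rintro A B rfl; rfl
  exact (aux _ _ hd).symm

theorem isSmoothForm_extDFun {s : ∀ x : M, AltFiber E M r x} (hs : IsSmoothForm s) :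
    IsSmoothForm (extDFun s) := by
  intro x₀
  rw [contMDiffAt_form_iff]
  have hz := mem_extChartAt_target (I := 𝓘(ℝ, E)) x₀
  have : rep x₀ (extDFun s) =ᶠ[𝓝 (extChartAt 𝓘(ℝ, E) x₀ x₀)] extDeriv (rep x₀ s) := by
    filter_upwards [target_nhds hz] with w hw using rep_extDFun hs x₀ hw
  refine ContDiffAt.congr_of_eventuallyEq ?_ this
  exact (ContinuousAlternatingMap.alternatizeUncurryFinCLM ℝ E ℝ).contDiff.contDiffAt.comp _
    ((rep_contDiffAt hs x₀ hz).fderiv_right (m := ∞) (by simp))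

theorem extDFun_pullback {g : N → M} (hg : ContMDiff 𝓘(ℝ, E) 𝓘(ℝ, E) ∞ g)
    {s : ∀ x : M, AltFiber E M r x} (hs : IsSmoothForm s) :
    extDFun (pullbackFun g s) = pullbackFun g (extDFun s) := by
  funext y
  have hz := mem_extChartAt_target (I := 𝓘(ℝ, E)) y
  have hl : (extChartAt 𝓘(ℝ, E) y).symm (extChartAt 𝓘(ℝ, E) y y) = y := extChartAt_to_inv y
  have hx : g ((extChartAt 𝓘(ℝ, E) y).symm (extChartAt 𝓘(ℝ, E) y y)) ∈
      (extChartAt 𝓘(ℝ, E) (g y)).source := by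
    rw [hl]; exact mem_extChartAt_source _
  have h := extDeriv_rep_pullback hg hs y (g y) hz hx
  rw [hl] at h
  have hgm : MDifferentiableAt 𝓘(ℝ, E) 𝓘(ℝ, E) g y := (hg y).mdifferentiableAt (by simp)
  have hφ := mdiff_chart (mem_chart_source E (g y))
  have hc := mdiff_chart (mem_chart_source E y)
  set G : E → E := fun z => extChartAt 𝓘(ℝ, E) (g y) (g ((extChartAt 𝓘(ℝ, E) y).symm z)) with hG
  have hGd : MDifferentiableAt 𝓘(ℝ, E) 𝓘(ℝ, E) G (extChartAt 𝓘(ℝ, E) y y) :=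
    ((coord_contDiffAt y (g y) hz (hg _) hx).differentiableAt (by simp)).mdifferentiableAt
  have hev : G ∘ extChartAt 𝓘(ℝ, E) y =ᶠ[𝓝 y] extChartAt 𝓘(ℝ, E) (g y) ∘ g := by
    filter_upwards [source_nhds (mem_extChartAt_source (I := 𝓘(ℝ, E)) y)] with w hw
    simp only [hG, Function.comp_apply]
    rw [(extChartAt 𝓘(ℝ, E) y).left_inv hw]
  have key : (mfderiv 𝓘(ℝ, E) 𝓘(ℝ, E) G (extChartAt 𝓘(ℝ, E) y y)).comp
      (mfderiv 𝓘(ℝ, E) 𝓘(ℝ, E) (extChartAt 𝓘(ℝ, E) y) y) =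
      (mfderiv 𝓘(ℝ, E) 𝓘(ℝ, E) (extChartAt 𝓘(ℝ, E) (g y)) (g y)).comp
        (mfderiv 𝓘(ℝ, E) 𝓘(ℝ, E) g y) := by
    have a := mfderiv_comp y hGd hc
    have b := mfderiv_comp y hφ hgm
    have c := hev.mfderiv_eq (I := 𝓘(ℝ, E)) (I' := 𝓘(ℝ, E))
    exact a.symm.trans (Eq.trans c b)
  rw [mfderiv_eq_fderiv] at key
  have aux : ∀ A B : E →L[ℝ] E, A = B →
      (extDeriv (rep (g y) s) (extChartAt 𝓘(ℝ, E) (g y) (g y))).compContinuousLinearMap A =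
      (extDeriv (rep (g y) s) (extChartAt 𝓘(ℝ, E) (g y) (g y))).compContinuousLinearMap B := by
    rintro A B rfl; rfl
  have fin := aux _ _ key
  change ContinuousAlternatingMap.compContinuousLinearMap _ _ = _
  rw [h]
  exact fin


/-! ### Wedge product with a one-form -/

/-- On a vector space, the wedge product `a ∧ b` of an alternating `1`-form with an alternating
`r`-form, `(a ∧ b)(v₀, …, vᵣ) = ∑ i, (-1)ⁱ a(vᵢ) b(v₀, …, v̂ᵢ, …, vᵣ)`. -/
def wedge₁ (a : E [⋀^Fin 1]→L[ℝ] ℝ) (b : E [⋀^Fin r]→L[ℝ] ℝ) : E [⋀^Fin (r + 1)]→L[ℝ] ℝ :=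
  ContinuousAlternatingMap.alternatizeUncurryFin
    (((ContinuousAlternatingMap.ofSubsingletonLIE (𝕜 := ℝ) (E := E) (F := ℝ) (0 : Fin 1)).symm a).smulRight b)

theorem wedge₁_apply (a : E [⋀^Fin 1]→L[ℝ] ℝ) (b : E [⋀^Fin r]→L[ℝ] ℝ) (v : Fin (r + 1) → E) :
    wedge₁ a b v = ∑ i : Fin (r + 1), (-1 : ℝ) ^ (i : ℕ) * (a (fun _ => v i) * b (i.removeNth v)) := by
  rw [wedge₁, ContinuousAlternatingMap.alternatizeUncurryFin_apply]
  refine Finset.sum_congr rfl fun i _ => ?_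
  rw [zsmul_eq_mul]
  push_cast
  rfl

theorem wedge₁_add (a : E [⋀^Fin 1]→L[ℝ] ℝ) (b b' : E [⋀^Fin r]→L[ℝ] ℝ) :
    wedge₁ a (b + b') = wedge₁ a b + wedge₁ a b' := by
  ext v
  simp only [wedge₁_apply, ContinuousAlternatingMap.add_apply, mul_add, Finset.sum_add_distrib]

theorem wedge₁_smul (c : ℝ) (a : E [⋀^Fin 1]→L[ℝ] ℝ) (b : E [⋀^Fin r]→L[ℝ] ℝ) :
    wedge₁ a (c • b) = c • wedge₁ a b := by
  ext v
  simp only [wedge₁_apply, ContinuousAlternatingMap.smul_apply, smul_eq_mul, Finset.mul_sum]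
  refine Finset.sum_congr rfl fun i _ => ?_
  ring

theorem wedge₁_comp {F : Type*} [NormedAddCommGroup F] [NormedSpace ℝ F]
    (a : E [⋀^Fin 1]→L[ℝ] ℝ) (b : E [⋀^Fin r]→L[ℝ] ℝ) (A : F →L[ℝ] E) :
    (wedge₁ a b).compContinuousLinearMap A =
      wedge₁ (a.compContinuousLinearMap A) (b.compContinuousLinearMap A) := by
  ext v
  rw [ContinuousAlternatingMap.compContinuousLinearMap_apply, wedge₁_apply, wedge₁_apply]
  rfl

theorem contDiff_wedge₁ :
    ContDiff ℝ ∞ (fun p : (E [⋀^Fin 1]→L[ℝ] ℝ) × (E [⋀^Fin r]→L[ℝ] ℝ) => wedge₁ p.1 p.2) := by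
  have h1 : ContDiff ℝ ∞ (ContinuousAlternatingMap.alternatizeUncurryFinCLM (n := r) ℝ E ℝ) :=
    ContinuousLinearMap.contDiff _
  have h2 : ContDiff ℝ ∞ (fun p : (E [⋀^Fin 1]→L[ℝ] ℝ) × (E [⋀^Fin r]→L[ℝ] ℝ) =>
      (ContinuousAlternatingMap.ofSubsingletonLIE (𝕜 := ℝ) (E := E) (F := ℝ) (0 : Fin 1)).symm p.1) :=
    (LinearIsometryEquiv.contDiff _).comp contDiff_fst
  exact h1.comp (h2.smulRight contDiff_snd)

/-- Pointwise wedge product of a `1`-form and an `r`-form on a manifold. -/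
def wedgeFun (α : ∀ x : M, AltFiber E M 1 x) (s : ∀ x : M, AltFiber E M r x) :
    ∀ x : M, AltFiber E M (r + 1) x :=
  fun x => wedge₁ (E := E) (α x) (s x)

theorem pullbackFun_wedge (g : N → M) (α : ∀ x : M, AltFiber E M 1 x)
    (s : ∀ x : M, AltFiber E M r x) :
    pullbackFun g (wedgeFun α s) = wedgeFun (pullbackFun g α) (pullbackFun g s) := by
  funext x
  exact wedge₁_comp (E := E) (F := E) (α (g x)) (s (g x)) (mfderiv 𝓘(ℝ, E) 𝓘(ℝ, E) g x)

theorem isSmoothForm_wedge {α : ∀ x : M, AltFiber E M 1 x} {s : ∀ x : M, AltFiber E M r x}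
    (hα : IsSmoothForm α) (hs : IsSmoothForm s) : IsSmoothForm (wedgeFun α s) := by
  intro x₀
  rw [contMDiffAt_form_iff]
  have h : rep x₀ (wedgeFun α s) = fun y => wedge₁ (rep x₀ α y) (rep x₀ s y) :=
    pullbackFun_wedge _ α s
  have h1 := (contMDiffAt_form_iff α x₀).1 (hα x₀)
  have h2 := (contMDiffAt_form_iff s x₀).1 (hs x₀)
  rw [h]
  exact ContDiffAt.comp (g := fun p : (E [⋀^Fin 1]→L[ℝ] ℝ) × (E [⋀^Fin r]→L[ℝ] ℝ) => wedge₁ p.1 p.2)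
    (f := fun y => (rep x₀ α y, rep x₀ s y)) _ contDiff_wedge₁.contDiffAt (h1.prodMk h2)

/-- A function regarded as a `0`-form. -/
def zeroFormFun (f : M → ℝ) : ∀ x : M, AltFiber E M 0 x :=
  fun x => ContinuousAlternatingMap.constOfIsEmpty ℝ (TangentSpace 𝓘(ℝ, E) x) (Fin 0) (f x)

theorem isSmoothForm_zeroForm {f : M → ℝ} (hf : ContMDiff 𝓘(ℝ, E) 𝓘(ℝ, ℝ) ∞ f) :
    IsSmoothForm (zeroFormFun (E := E) f) := by
  intro x₀
  rw [contMDiffAt_form_iff]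
  have hz := mem_extChartAt_target (I := 𝓘(ℝ, E)) x₀
  have h1 : ContMDiffAt 𝓘(ℝ, E) 𝓘(ℝ, ℝ) ∞ (f ∘ (extChartAt 𝓘(ℝ, E) x₀).symm)
      (extChartAt 𝓘(ℝ, E) x₀ x₀) :=
    (hf _).comp _ ((contMDiffOn_extChartAt_symm x₀).contMDiffAt (target_nhds hz))
  rw [contMDiffAt_iff_contDiffAt] at h1
  exact (ContinuousAlternatingMap.constOfIsEmptyLIE ℝ E ℝ (Fin 0)).contDiff.contDiffAt.comp _ h1

end Forms

/-! ### Operators on smooth forms -/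

section Operators

variable {E : Type*} [NormedAddCommGroup E] [NormedSpace ℝ E]
  {M : Type*} [TopologicalSpace M] [ChartedSpace E M] [IsManifold 𝓘(ℝ, E) ∞ M]
  {N : Type*} [TopologicalSpace N] [ChartedSpace E N] [IsManifold 𝓘(ℝ, E) ∞ N]
  {P : Type*} [TopologicalSpace P] [ChartedSpace E P] [IsManifold 𝓘(ℝ, E) ∞ P]
  {r : ℕ}

namespace DiffForm

instance instAddCommGroup : AddCommGroup (DiffForm E M r) := ContMDiffSection.instAddCommGroup
instance instModule : Module ℝ (DiffForm E M r) := ContMDiffSection.instModule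

theorem extDFun_add {s t : ∀ x : M, AltFiber E M r x} (hs : IsSmoothForm s) (ht : IsSmoothForm t) :
    extDFun (s + t) = extDFun s + extDFun t := by
  funext x
  have hz := mem_extChartAt_target (I := 𝓘(ℝ, E)) x
  have h : extDeriv (rep x (s + t)) (extChartAt 𝓘(ℝ, E) x x) = _ :=
    extDeriv_add ((rep_contDiffAt hs x hz).differentiableAt (by simp))
      ((rep_contDiffAt ht x hz).differentiableAt (by simp))
  unfold extDFun
  rw [h]
  rfl

theorem extDFun_smul (c : ℝ) (s : ∀ x : M, AltFiber E M r x) :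
    extDFun (c • s) = c • extDFun s := by
  funext x
  have h : extDeriv (rep x (c • s)) (extChartAt 𝓘(ℝ, E) x x) = _ :=
    extDeriv_smul c (rep x s)
  unfold extDFun
  rw [h]
  rfl

/-- The exterior derivative `d : Ωʳ(M) → Ωʳ⁺¹(M)`. -/
def d (r : ℕ) : DiffForm E M r →ₗ[ℝ] DiffForm E M (r + 1) where
  toFun φ := ⟨extDFun φ, isSmoothForm_extDFun φ.contMDiff⟩
  map_add' φ ψ := ContMDiffSection.ext fun x => congrFun (extDFun_add φ.contMDiff ψ.contMDiff) x
  map_smul' c φ := ContMDiffSection.ext fun x => congrFun (extDFun_smul c φ) x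

/-- The wedge product `φ ↦ α ∧ φ` with a `1`-form `α`. -/
def wedge (α : DiffForm E M 1) : DiffForm E M r →ₗ[ℝ] DiffForm E M (r + 1) where
  toFun φ := ⟨wedgeFun α φ, isSmoothForm_wedge α.contMDiff φ.contMDiff⟩
  map_add' φ ψ := by
    refine ContMDiffSection.ext fun x => ?_
    exact wedge₁_add (E := E) (α x) (φ x) (ψ x)
  map_smul' c φ := by
    refine ContMDiffSection.ext fun x => ?_
    exact wedge₁_smul (E := E) c (α x) (φ x)

/-- The product `φ ↦ f φ` with a smooth function `f`. -/
def funSMul (f : C^∞⟮𝓘(ℝ, E), M; ℝ⟯) : DiffForm E M r →ₗ[ℝ] DiffForm E M r where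
  toFun φ := ⟨fun x => f x • φ x, f.contMDiff.smul_section φ.contMDiff⟩
  map_add' φ ψ := ContMDiffSection.ext fun x => smul_add (f x) (φ x) (ψ x)
  map_smul' c φ := ContMDiffSection.ext fun x => smul_comm (f x) c (φ x)

/-- A smooth function regarded as a `0`-form. -/
def ofFun (f : C^∞⟮𝓘(ℝ, E), M; ℝ⟯) : DiffForm E M 0 :=
  ⟨zeroFormFun f, isSmoothForm_zeroForm f.contMDiff⟩

/-- The pullback `g^* : Ωʳ(M) → Ωʳ(N)` by a smooth map `g : N → M`. -/
def pullback (g : C^∞⟮𝓘(ℝ, E), N; 𝓘(ℝ, E), M⟯) : DiffForm E M r →ₗ[ℝ] DiffForm E N r where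
  toFun φ := ⟨pullbackFun g φ, isSmoothForm_pullback g.contMDiff φ.contMDiff⟩
  map_add' _ _ := rfl
  map_smul' _ _ := rfl

theorem pullback_comp (g : C^∞⟮𝓘(ℝ, E), N; 𝓘(ℝ, E), M⟯) (h : C^∞⟮𝓘(ℝ, E), P; 𝓘(ℝ, E), N⟯)
    (φ : DiffForm E M r) : pullback (g.comp h) φ = pullback h (pullback g φ) := by
  refine ContMDiffSection.ext fun x => ?_
  have key : mfderiv 𝓘(ℝ, E) 𝓘(ℝ, E) (g.comp h) x =
      (mfderiv 𝓘(ℝ, E) 𝓘(ℝ, E) g (h x)).comp (mfderiv 𝓘(ℝ, E) 𝓘(ℝ, E) h x) :=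
    mfderiv_comp x ((g.contMDiff _).mdifferentiableAt (by simp))
      ((h.contMDiff _).mdifferentiableAt (by simp))
  change ContinuousAlternatingMap.compContinuousLinearMap (φ (g (h x)))
    (mfderiv 𝓘(ℝ, E) 𝓘(ℝ, E) (g.comp h) x) = _
  rw [key]
  rfl

theorem pullback_d (g : C^∞⟮𝓘(ℝ, E), N; 𝓘(ℝ, E), M⟯) (φ : DiffForm E M r) :
    pullback g (d r φ) = d r (pullback g φ) :=
  ContMDiffSection.ext fun x => (congrFun (extDFun_pullback g.contMDiff φ.contMDiff) x).symm

theorem pullback_wedge (g : C^∞⟮𝓘(ℝ, E), N; 𝓘(ℝ, E), M⟯) (α : DiffForm E M 1)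
    (φ : DiffForm E M r) : pullback g (wedge α φ) = wedge (pullback g α) (pullback g φ) :=
  ContMDiffSection.ext fun x => congrFun (pullbackFun_wedge g α φ) x

theorem pullback_funSMul (g : C^∞⟮𝓘(ℝ, E), N; 𝓘(ℝ, E), M⟯) (f : C^∞⟮𝓘(ℝ, E), M; ℝ⟯)
    (φ : DiffForm E M r) : pullback g (funSMul f φ) = funSMul (f.comp g) (pullback g φ) :=
  ContMDiffSection.ext fun _ => rfl

theorem pullback_ofFun (g : C^∞⟮𝓘(ℝ, E), N; 𝓘(ℝ, E), M⟯) (f : C^∞⟮𝓘(ℝ, E), M; ℝ⟯) :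
    pullback g (ofFun f) = ofFun (f.comp g) :=
  ContMDiffSection.ext fun _ => rfl

/-- `d_f φ = f dφ - r df ∧ φ` for an `r`-form `φ`. -/
def dFun (f : C^∞⟮𝓘(ℝ, E), M; ℝ⟯) (r : ℕ) : DiffForm E M r →ₗ[ℝ] DiffForm E M (r + 1) :=
  funSMul f ∘ₗ d r -
    (r : ℝ) • (wedge (d 0 (ofFun f)) : DiffForm E M r →ₗ[ℝ] DiffForm E M (r + 1))

/-- `d_{f,θ} φ = d_f φ - f θ ∧ φ`. -/
def dTwist (f : C^∞⟮𝓘(ℝ, E), M; ℝ⟯) (θ : DiffForm E M 1) (r : ℕ) :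
    DiffForm E M r →ₗ[ℝ] DiffForm E M (r + 1) :=
  dFun f r - wedge (funSMul f θ)

theorem pullback_dTwist (g : C^∞⟮𝓘(ℝ, E), N; 𝓘(ℝ, E), M⟯) (f : C^∞⟮𝓘(ℝ, E), M; ℝ⟯)
    (θ : DiffForm E M 1) (φ : DiffForm E M r) :
    pullback g (dTwist f θ r φ) = dTwist (f.comp g) (pullback g θ) r (pullback g φ) := by
  simp only [dTwist, dFun, LinearMap.sub_apply, LinearMap.comp_apply, LinearMap.smul_apply,
    map_sub, map_smul, pullback_funSMul, pullback_d, pullback_wedge]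
  rw [← pullback_ofFun]

end DiffForm

/-! ### Cohomology -/

/-- The space of `d_{f,θ}`-closed `r`-forms. -/
def closedForms (f : C^∞⟮𝓘(ℝ, E), M; ℝ⟯) (θ : DiffForm E M 1) (r : ℕ) :
    Submodule ℝ (DiffForm E M r) :=
  LinearMap.ker (DiffForm.dTwist f θ r)

/-- The space of `d_{f,θ}`-exact `r`-forms. -/
def exactForms (f : C^∞⟮𝓘(ℝ, E), M; ℝ⟯) (θ : DiffForm E M 1) :
    ∀ r : ℕ, Submodule ℝ (DiffForm E M r)
  | 0 => ⊥
  | r + 1 => LinearMap.range (DiffForm.dTwist f θ r)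

/-- The cohomology group `H^r_{f,θ}(M)`: closed `r`-forms modulo exact `r`-forms. -/
abbrev Cohomology (f : C^∞⟮𝓘(ℝ, E), M; ℝ⟯) (θ : DiffForm E M 1) (r : ℕ) : Type _ :=
  closedForms f θ r ⧸ (exactForms f θ r).submoduleOf (closedForms f θ r)

namespace Cohomology

/-- The class of a closed form. -/
def mk (f : C^∞⟮𝓘(ℝ, E), M; ℝ⟯) (θ : DiffForm E M 1) (r : ℕ) :
    closedForms f θ r →ₗ[ℝ] Cohomology f θ r :=
  ((exactForms f θ r).submoduleOf (closedForms f θ r)).mkQ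

end Cohomology

/-- Pullback by `g : N → M`, from `d_{f,θ}`-closed forms to `d_{f',θ'}`-closed forms, where
`f' = f ∘ g` and `θ' = g^* θ`. -/
def closedForms.pullback (g : C^∞⟮𝓘(ℝ, E), N; 𝓘(ℝ, E), M⟯)
    {f : C^∞⟮𝓘(ℝ, E), M; ℝ⟯} {θ : DiffForm E M 1} {f' : C^∞⟮𝓘(ℝ, E), N; ℝ⟯} {θ' : DiffForm E N 1}
    (hf : f' = f.comp g) (hθ : θ' = DiffForm.pullback g θ) (r : ℕ) :
    closedForms f θ r →ₗ[ℝ] closedForms f' θ' r :=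
  (DiffForm.pullback g).restrict fun φ hφ => by
    subst hf hθ
    have hφ' : DiffForm.dTwist f θ r φ = 0 := hφ
    change DiffForm.dTwist _ _ r (DiffForm.pullback g φ) = 0
    rw [← DiffForm.pullback_dTwist, hφ', map_zero]

theorem pullback_mem_exactForms (g : C^∞⟮𝓘(ℝ, E), N; 𝓘(ℝ, E), M⟯)
    (f : C^∞⟮𝓘(ℝ, E), M; ℝ⟯) (θ : DiffForm E M 1) :
    ∀ (r : ℕ) (φ : DiffForm E M r), φ ∈ exactForms f θ r →
      DiffForm.pullback g φ ∈ exactForms (f.comp g) (DiffForm.pullback g θ) r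
  | 0, φ, h => by
    have h' : φ = 0 := h
    rw [h', map_zero]
    exact Submodule.zero_mem _
  | r + 1, φ, h => by
    obtain ⟨ψ, rfl⟩ := h
    exact ⟨DiffForm.pullback g ψ, (DiffForm.pullback_dTwist g f θ ψ).symm⟩

/-- The induced map `H^r_{f,θ}(M) → H^r_{f∘g,g^*θ}(N)`, `[φ] ↦ [g^* φ]`. -/
def Cohomology.pullback (g : C^∞⟮𝓘(ℝ, E), N; 𝓘(ℝ, E), M⟯)
    {f : C^∞⟮𝓘(ℝ, E), M; ℝ⟯} {θ : DiffForm E M 1} {f' : C^∞⟮𝓘(ℝ, E), N; ℝ⟯} {θ' : DiffForm E N 1}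
    (hf : f' = f.comp g) (hθ : θ' = DiffForm.pullback g θ) (r : ℕ) :
    Cohomology f θ r →ₗ[ℝ] Cohomology f' θ' r :=
  Submodule.mapQ _ _ (closedForms.pullback g hf hθ r) fun φ hφ => by
    subst hf hθ
    exact pullback_mem_exactForms g f θ r φ hφ

end Operators

/-! ### Open subsets -/

section Open

open TopologicalSpace (Opens)

variable {E : Type*} [NormedAddCommGroup E] [NormedSpace ℝ E]
  {M : Type*} [TopologicalSpace M] [ChartedSpace E M] [IsManifold 𝓘(ℝ, E) ∞ M] {r : ℕ}

/-- The inclusion of an open subset, as a smooth map. -/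
def incl (U : Opens M) : C^∞⟮𝓘(ℝ, E), U; 𝓘(ℝ, E), M⟯ := ⟨Subtype.val, contMDiff_subtype_val⟩

/-- The inclusion of an open subset into a larger one, as a smooth map. -/
def inclLE {U V : Opens M} (h : U ≤ V) : C^∞⟮𝓘(ℝ, E), U; 𝓘(ℝ, E), V⟯ :=
  ⟨Opens.inclusion h, contMDiff_inclusion h⟩

/-- The restriction `f|_U`. -/
def resFun (U : Opens M) (f : C^∞⟮𝓘(ℝ, E), M; ℝ⟯) : C^∞⟮𝓘(ℝ, E), U; ℝ⟯ := f.comp (incl U)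

/-- The restriction `φ|_U`. -/
def resForm (U : Opens M) : DiffForm E M r →ₗ[ℝ] DiffForm E U r := DiffForm.pullback (incl U)

theorem resForm_le {U V : Opens M} (h : U ≤ V) (φ : DiffForm E M r) :
    resForm U φ = DiffForm.pullback (inclLE h) (resForm V φ) :=
  DiffForm.pullback_comp (incl V) (inclLE h) φ

/-- `α_* : H^r_{f,θ}(M) → H^r_{f|U,θ|U}(U) ⊕ H^r_{f|V,θ|V}(V)`, `[φ] ↦ ([φ|_U], [φ|_V])`. -/
def alphaStar (f : C^∞⟮𝓘(ℝ, E), M; ℝ⟯) (θ : DiffForm E M 1) (U V : Opens M) (r : ℕ) :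
    Cohomology f θ r →ₗ[ℝ]
      Cohomology (resFun U f) (resForm U θ) r × Cohomology (resFun V f) (resForm V θ) r :=
  (Cohomology.pullback (incl U) rfl rfl r).prod (Cohomology.pullback (incl V) rfl rfl r)

/-- The restriction map `H^r_{f|U,θ|U}(U) → H^r_{f|W,θ|W}(W)`, `[φ] ↦ [φ|_W]`, for open `W ⊆ U`. -/
def resCohomology (f : C^∞⟮𝓘(ℝ, E), M; ℝ⟯) (θ : DiffForm E M 1) {W U : Opens M} (h : W ≤ U)
    (r : ℕ) :
    Cohomology (resFun U f) (resForm U θ) r →ₗ[ℝ] Cohomology (resFun W f) (resForm W θ) r :=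
  Cohomology.pullback (inclLE h) rfl (resForm_le h θ) r

/-- `β_* : H^r_{f|U,θ|U}(U) ⊕ H^r_{f|V,θ|V}(V) → H^r_{f|U∩V,θ|U∩V}(U ∩ V)`,
`([φ], [ψ]) ↦ [φ|_{U∩V} - ψ|_{U∩V}]`. -/
def betaStar (f : C^∞⟮𝓘(ℝ, E), M; ℝ⟯) (θ : DiffForm E M 1) (U V : Opens M) (r : ℕ) :
    (Cohomology (resFun U f) (resForm U θ) r × Cohomology (resFun V f) (resForm V θ) r) →ₗ[ℝ]
      Cohomology (resFun (U ⊓ V) f) (resForm (U ⊓ V) θ) r :=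
  (resCohomology f θ (W := U ⊓ V) (U := U) inf_le_left r).comp (LinearMap.fst ℝ
      (Cohomology (resFun U f) (resForm U θ) r) (Cohomology (resFun V f) (resForm V θ) r)) -
    (resCohomology f θ (W := U ⊓ V) (U := V) inf_le_right r).comp (LinearMap.snd ℝ
      (Cohomology (resFun U f) (resForm U θ) r) (Cohomology (resFun V f) (resForm V θ) r))

theorem alphaStar_mk (f : C^∞⟮𝓘(ℝ, E), M; ℝ⟯) (θ : DiffForm E M 1) (U V : Opens M) (r : ℕ)
    (φ : closedForms f θ r) :
    alphaStar f θ U V r (Cohomology.mk f θ r φ) =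
      (Cohomology.mk _ _ r (closedForms.pullback (incl U) rfl rfl r φ),
        Cohomology.mk _ _ r (closedForms.pullback (incl V) rfl rfl r φ)) :=
  rfl

theorem betaStar_mk (f : C^∞⟮𝓘(ℝ, E), M; ℝ⟯) (θ : DiffForm E M 1) (U V : Opens M) (r : ℕ)
    (φ : closedForms (resFun U f) (resForm U θ) r)
    (ψ : closedForms (resFun V f) (resForm V θ) r) :
    betaStar f θ U V r (Cohomology.mk _ _ r φ, Cohomology.mk _ _ r ψ) =
      Cohomology.mk (resFun (U ⊓ V) f) (resForm (U ⊓ V) θ) r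
        (closedForms.pullback (inclLE inf_le_left) rfl (resForm_le inf_le_left θ) r φ -
          closedForms.pullback (inclLE inf_le_right) rfl (resForm_le inf_le_right θ) r ψ) :=
  rfl

/-- `η` is the extension by `0` to `M` of the form `τ` on the open subset `W`. -/
def IsExtensionByZero {W : Opens M} (τ : DiffForm E W r) (η : DiffForm E M r) : Prop :=
  resForm W η = τ ∧ ∀ x : M, x ∉ W → η x = 0

end Open
end LichCoh

end

open LichCoh

/-!
Multiplication by `λ_V` and by `-λ_U`, followed by extension by zero, splits
`Ωʳ(U) ⊕ Ωʳ(V) → Ωʳ(U ∩ V)`, so `0 → Ωʳ(M) → Ωʳ(U) ⊕ Ωʳ(V) → Ωʳ(U ∩ V) → 0` is exact for every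
`r`. The operator `d_{f,θ}` induces a map from forms modulo exact forms to closed forms one degree
higher, whose kernel and cokernel are consecutive cohomology groups; the long exact sequence is the
snake lemma for these maps. The formula for `δ` is the Leibniz rule
`d_{f,θ}(g φ) = d_f g ∧ φ + g d_{f,θ} φ` applied to the lift `(λ_V σ, -λ_U σ)` of a closed form `σ`.
-/

noncomputable section

namespace LichCoh

open TopologicalSpace (Opens)

section VectorSpace

open ContinuousAlternatingMap

variable {E : Type*} [NormedAddCommGroup E] [NormedSpace ℝ E] {r : ℕ}

theorem alternatizeUncurryFin_comp_eq_neg {𝕜 V F : Type*} [NontriviallyNormedField 𝕜]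
    [NormedAddCommGroup V] [NormedSpace 𝕜 V] [NormedAddCommGroup F] [NormedSpace 𝕜 F]
    {f g : V →L[𝕜] V →L[𝕜] V [⋀^Fin r]→L[𝕜] F} (h : ∀ v w, (f + g) v w = (f + g) w v) :
    alternatizeUncurryFin (alternatizeUncurryFinCLM 𝕜 V F ∘L f) =
      -alternatizeUncurryFin (alternatizeUncurryFinCLM 𝕜 V F ∘L g) := by
  rw [eq_neg_iff_add_eq_zero, ← alternatizeUncurryFin_add, ← ContinuousLinearMap.comp_add]
  exact alternatizeUncurryFin_alternatizeUncurryFinCLM_comp_of_symmetric h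

theorem alternatizeUncurryFinCLM_comp_smulRight {𝕜 V F : Type*} [NontriviallyNormedField 𝕜]
    [NormedAddCommGroup V] [NormedSpace 𝕜 V] [NormedAddCommGroup F] [NormedSpace 𝕜 F]
    (a : V →L[𝕜] 𝕜) (f : V →L[𝕜] V [⋀^Fin r]→L[𝕜] F) :
    alternatizeUncurryFinCLM 𝕜 V F ∘L a.smulRight f = a.smulRight (alternatizeUncurryFin f) := by
  ext1 v
  exact alternatizeUncurryFin_smul (a v) f

theorem smul_wedge₁ (c : ℝ) (a : E [⋀^Fin 1]→L[ℝ] ℝ) (b : E [⋀^Fin r]→L[ℝ] ℝ) :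
    wedge₁ (c • a) b = c • wedge₁ a b := by
  ext v
  simp only [wedge₁_apply, ContinuousAlternatingMap.smul_apply, smul_eq_mul, Finset.mul_sum]
  exact Finset.sum_congr rfl fun i _ => by ring

theorem neg_wedge₁ (a : E [⋀^Fin 1]→L[ℝ] ℝ) (b : E [⋀^Fin r]→L[ℝ] ℝ) :
    wedge₁ (-a) b = -wedge₁ a b := by
  ext v
  simp [wedge₁_apply]

theorem wedge₁_anticomm (a b : E [⋀^Fin 1]→L[ℝ] ℝ) (c : E [⋀^Fin r]→L[ℝ] ℝ) :
    wedge₁ a (wedge₁ b c) = -wedge₁ b (wedge₁ a c) := by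
  simp only [wedge₁, ← alternatizeUncurryFinCLM_comp_smulRight]
  refine alternatizeUncurryFin_comp_eq_neg fun v w => ?_
  simp only [_root_.add_apply, ContinuousLinearMap.smulRight_apply, _root_.smul_apply]
  module

theorem extDeriv_fun_smul_eq_wedge₁_add {g : E → ℝ} {φ : E → E [⋀^Fin r]→L[ℝ] ℝ} {x : E}
    (hg : DifferentiableAt ℝ g x) (hφ : DifferentiableAt ℝ φ x) :
    extDeriv (fun y => g y • φ y) x =
      wedge₁ (extDeriv (fun y => constOfIsEmpty ℝ E (Fin 0) (g y)) x) (φ x) +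
        g x • extDeriv φ x := by
  rw [extDeriv_constOfIsEmpty, wedge₁, extDeriv, extDeriv, fderiv_fun_smul hg hφ,
    alternatizeUncurryFin_add, alternatizeUncurryFin_smul]
  exact add_comm _ _

theorem fderiv_apply_comm_of_extDeriv_eq_zero {a : E → E [⋀^Fin 1]→L[ℝ] ℝ} {x : E}
    (h : extDeriv a x = 0) (v w : E) :
    fderiv ℝ a x v (fun _ => w) = fderiv ℝ a x w (fun _ => v) := by
  have hvw : extDeriv a x ![v, w] = 0 := by rw [h]; rfl
  have h0 : (0 : Fin 2).removeNth ![v, w] = fun _ => w := by funext i; fin_cases i; rfl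
  have h1 : (1 : Fin 2).removeNth ![v, w] = fun _ => v := by funext i; fin_cases i; rfl
  rw [extDeriv, alternatizeUncurryFin_apply, Fin.sum_univ_two, h0, h1] at hvw
  simpa [← sub_eq_add_neg, sub_eq_zero] using hvw

theorem exists_hasFDerivAt_smulRight {𝕜 V W F : Type*} [NontriviallyNormedField 𝕜]
    [NormedAddCommGroup V] [NormedSpace 𝕜 V] [NormedAddCommGroup W] [NormedSpace 𝕜 W]
    [NormedAddCommGroup F] [NormedSpace 𝕜 F] {a : V → W →L[𝕜] 𝕜} {a' : V →L[𝕜] W →L[𝕜] 𝕜}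
    {b : V → F} {b' : V →L[𝕜] F} {x : V} (ha : HasFDerivAt a a' x) (hb : HasFDerivAt b b' x) :
    ∃ D : V →L[𝕜] W →L[𝕜] F, HasFDerivAt (fun y => (a y).smulRight (b y)) D x ∧
      ∀ v w, D v w = a x w • b' v + a' v w • b x :=
  ⟨_, (ContinuousLinearMap.smulRightL 𝕜 W F).hasFDerivAt_of_bilinear ha hb, fun _ _ => rfl⟩

theorem extDeriv_wedge₁ {a : E → E [⋀^Fin 1]→L[ℝ] ℝ} {b : E → E [⋀^Fin r]→L[ℝ] ℝ} {x : E}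
    (ha : DifferentiableAt ℝ a x) (hb : DifferentiableAt ℝ b x) (h : extDeriv a x = 0) :
    extDeriv (fun y => wedge₁ (a y) (b y)) x = -wedge₁ (a x) (extDeriv b x) := by
  let L : (E [⋀^Fin 1]→L[ℝ] ℝ) →L[ℝ] (E →L[ℝ] ℝ) :=
    (ofSubsingletonLIE (𝕜 := ℝ) (E := E) (F := ℝ) (0 : Fin 1)).symm.toContinuousLinearEquiv
  have hL : HasFDerivAt (fun y => L (a y)) (L ∘L fderiv ℝ a x) x :=
    L.hasFDerivAt.comp x ha.hasFDerivAt
  obtain ⟨D, hD, hD_apply⟩ := exists_hasFDerivAt_smulRight hL hb.hasFDerivAt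
  have hwedge : HasFDerivAt (fun y => wedge₁ (a y) (b y))
      (alternatizeUncurryFinCLM ℝ E ℝ ∘L D) x :=
    (alternatizeUncurryFinCLM ℝ E ℝ).hasFDerivAt.comp x hD
  have hcomm : ∀ v w, L (fderiv ℝ a x v) w = L (fderiv ℝ a x w) v :=
    fderiv_apply_comm_of_extDeriv_eq_zero h
  have hsymm : ∀ v w, (D + (L (a x)).smulRight (fderiv ℝ b x)) v w =
      (D + (L (a x)).smulRight (fderiv ℝ b x)) w v := by
    intro v w
    simp only [_root_.add_apply, hD_apply, ContinuousLinearMap.smulRight_apply,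
      ContinuousLinearMap.comp_apply, _root_.smul_apply, hcomm v w]
    module
  calc extDeriv (fun y => wedge₁ (a y) (b y)) x
      = alternatizeUncurryFin (alternatizeUncurryFinCLM ℝ E ℝ ∘L D) := by
        rw [extDeriv, hwedge.fderiv]
    _ = -alternatizeUncurryFin
          (alternatizeUncurryFinCLM ℝ E ℝ ∘L (L (a x)).smulRight (fderiv ℝ b x)) :=
        alternatizeUncurryFin_comp_eq_neg hsymm
    _ = -wedge₁ (a x) (extDeriv b x) := by
        rw [alternatizeUncurryFinCLM_comp_smulRight]
        rfl

end VectorSpace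

variable {E : Type*} [NormedAddCommGroup E] [NormedSpace ℝ E]
  {M : Type*} [TopologicalSpace M] [ChartedSpace E M] [IsManifold 𝓘(ℝ, E) ∞ M]
  {N : Type*} [TopologicalSpace N] [ChartedSpace E N] [IsManifold 𝓘(ℝ, E) ∞ N] {r : ℕ}

theorem rep_extChartAt_self (s : ∀ x : M, AltFiber E M r x) (x : M) :
    rep x s (extChartAt 𝓘(ℝ, E) x x) = s x := by
  have hderiv : mfderiv 𝓘(ℝ, E) 𝓘(ℝ, E) (extChartAt 𝓘(ℝ, E) x).symm (extChartAt 𝓘(ℝ, E) x x) =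
      ContinuousLinearMap.id ℝ E := by
    have h := mfderivWithin_range_extChartAt_symm (I := 𝓘(ℝ, E)) (x := x)
    rwa [show Set.range 𝓘(ℝ, E) = Set.univ by simp, mfderivWithin_univ] at h
  -- The base point `(extChartAt x).symm (extChartAt x x)` equals `x` only propositionally.
  have comp_id : ∀ (p : M) (_ : p = x) (A : E →L[ℝ] E), A = ContinuousLinearMap.id ℝ E →
      ContinuousAlternatingMap.compContinuousLinearMap
        (show E [⋀^Fin r]→L[ℝ] ℝ from s p) A = s x := by
    rintro p rfl A rfl; rfl
  exact comp_id _ (extChartAt_to_inv x) _ hderiv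

namespace DiffForm

theorem differentiableAt_rep (φ : DiffForm E M r) (x : M) :
    DifferentiableAt ℝ (rep x φ) (extChartAt 𝓘(ℝ, E) x x) :=
  (rep_contDiffAt φ.contMDiff x (mem_extChartAt_target x)).differentiableAt (by simp)

theorem d_apply (φ : DiffForm E M r) (x : M) :
    d r φ x = extDeriv (rep x φ) (extChartAt 𝓘(ℝ, E) x x) :=
  (rep_extChartAt_self (d r φ) x).symm.trans
    (rep_extDFun φ.contMDiff x (mem_extChartAt_target x))

theorem rep_d_eventuallyEq (φ : DiffForm E M r) (x : M) :
    rep x (d r φ) =ᶠ[𝓝 (extChartAt 𝓘(ℝ, E) x x)] extDeriv (rep x φ) := by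
  filter_upwards [target_nhds (mem_extChartAt_target (I := 𝓘(ℝ, E)) x)] with z hz
    using rep_extDFun φ.contMDiff x hz

theorem d_d (φ : DiffForm E M r) : d (r + 1) (d r φ) = 0 :=
  ContMDiffSection.ext fun x => (d_apply _ x).trans <|
    (rep_d_eventuallyEq φ x).extDeriv_eq.trans <|
      extDeriv_extDeriv_apply (rep_contDiffAt φ.contMDiff x (mem_extChartAt_target x)) <| by
        rw [minSmoothness_of_isRCLikeNormedField]
        exact WithTop.coe_le_coe.2 le_top

theorem d_funSMul (f : C^∞⟮𝓘(ℝ, E), M; ℝ⟯) (φ : DiffForm E M r) :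
    d r (funSMul f φ) = wedge (d 0 (ofFun f)) φ + funSMul f (d r φ) := by
  refine ContMDiffSection.ext fun x => (d_apply _ x).trans ?_
  have hf : DifferentiableAt ℝ (f ∘ (extChartAt 𝓘(ℝ, E) x).symm) (extChartAt 𝓘(ℝ, E) x x) := by
    refine (contMDiffAt_iff_contDiffAt.1 ((f.contMDiff _).comp _ ?_)).differentiableAt
      (n := ∞) (by simp)
    exact (contMDiffOn_extChartAt_symm x).contMDiffAt (target_nhds (mem_extChartAt_target x))
  have h := extDeriv_fun_smul_eq_wedge₁_add hf (differentiableAt_rep φ x)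
  rw [rep_extChartAt_self φ x, Function.comp_apply, extChartAt_to_inv] at h
  change _ = wedge₁ (E := E) (d 0 (ofFun f) x) (φ x) +
    f x • (show E [⋀^Fin (r + 1)]→L[ℝ] ℝ from d r φ x)
  rw [d_apply, d_apply]
  exact h

theorem d_wedge {α : DiffForm E M 1} (hα : d 1 α = 0) (φ : DiffForm E M r) :
    d (r + 1) (wedge α φ) = -wedge α (d r φ) := by
  refine ContMDiffSection.ext fun x => (d_apply _ x).trans ?_
  have hαx : extDeriv (rep x α) (extChartAt 𝓘(ℝ, E) x x) = 0 := by
    rw [← d_apply, hα]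
    rfl
  have h := extDeriv_wedge₁ (differentiableAt_rep α x) (differentiableAt_rep φ x) hαx
  rw [rep_extChartAt_self α x, ← d_apply] at h
  have hrep : rep x (wedge α φ : DiffForm E M (r + 1)) =
      fun y => wedge₁ (rep x α y) (rep x φ y) := pullbackFun_wedge _ α φ
  rw [hrep]
  exact h

theorem d_ofFun_const (c : ℝ) :
    d 0 (ofFun (ContMDiffMap.const c : C^∞⟮𝓘(ℝ, E), M; ℝ⟯)) = 0 := by
  refine ContMDiffSection.ext fun x => (d_apply _ x).trans ?_
  have hrep : rep x (ofFun (ContMDiffMap.const c : C^∞⟮𝓘(ℝ, E), M; ℝ⟯)) =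
      fun _ : E => ContinuousAlternatingMap.constOfIsEmpty ℝ E (Fin 0) c := rfl
  rw [hrep, extDeriv_constOfIsEmpty, fderiv_fun_const]
  rfl

theorem ofFun_add (f g : C^∞⟮𝓘(ℝ, E), M; ℝ⟯) : ofFun (f + g) = ofFun f + ofFun g :=
  ContMDiffSection.ext fun _ => ContinuousAlternatingMap.ext fun _ => rfl

theorem wedge_anticomm (α β : DiffForm E M 1) (φ : DiffForm E M r) :
    wedge α (wedge β φ) = -wedge β (wedge α φ) :=
  ContMDiffSection.ext fun x => wedge₁_anticomm (E := E) (α x) (β x) (φ x)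

theorem wedge_self (α : DiffForm E M 1) (φ : DiffForm E M r) : wedge α (wedge α φ) = 0 := by
  have : IsAddTorsionFree (DiffForm E M (r + 1 + 1)) := .of_isTorsionFree ℝ _
  exact self_eq_neg.1 (wedge_anticomm α α φ)

theorem wedge_funSMul_left (f : C^∞⟮𝓘(ℝ, E), M; ℝ⟯) (α : DiffForm E M 1) (φ : DiffForm E M r) :
    wedge (funSMul f α) φ = funSMul f (wedge α φ) :=
  ContMDiffSection.ext fun x => smul_wedge₁ (E := E) (f x) (α x) (φ x)

theorem wedge_funSMul_right (f : C^∞⟮𝓘(ℝ, E), M; ℝ⟯) (α : DiffForm E M 1) (φ : DiffForm E M r) :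
    wedge α (funSMul f φ) = funSMul f (wedge α φ) :=
  ContMDiffSection.ext fun x => wedge₁_smul (E := E) (f x) (α x) (φ x)

theorem neg_wedge (α : DiffForm E M 1) (φ : DiffForm E M r) :
    wedge (-α) φ = -wedge α φ :=
  ContMDiffSection.ext fun x => neg_wedge₁ (E := E) (α x) (φ x)

theorem funSMul_comm (f g : C^∞⟮𝓘(ℝ, E), M; ℝ⟯) (φ : DiffForm E M r) :
    funSMul f (funSMul g φ) = funSMul g (funSMul f φ) :=
  ContMDiffSection.ext fun x => smul_comm (f x) (g x) (φ x)

theorem dFun_apply (f : C^∞⟮𝓘(ℝ, E), M; ℝ⟯) (φ : DiffForm E M r) :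
    dFun f r φ = funSMul f (d r φ) - (r : ℝ) • wedge (d 0 (ofFun f)) φ :=
  rfl

theorem dTwist_apply (f : C^∞⟮𝓘(ℝ, E), M; ℝ⟯) (θ : DiffForm E M 1) (φ : DiffForm E M r) :
    dTwist f θ r φ =
      funSMul f (d r φ) - (r : ℝ) • wedge (d 0 (ofFun f)) φ - funSMul f (wedge θ φ) := by
  rw [← wedge_funSMul_left]
  rfl

theorem dTwist_dTwist (f : C^∞⟮𝓘(ℝ, E), M; ℝ⟯) {θ : DiffForm E M 1} (hθ : d 1 θ = 0)
    (φ : DiffForm E M r) : dTwist f θ (r + 1) (dTwist f θ r φ) = 0 := by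
  have hf : d 1 (d 0 (ofFun f)) = 0 := d_d _
  simp only [dTwist_apply, map_sub, map_smul, d_funSMul, d_wedge hθ, d_wedge hf, d_d,
    wedge_funSMul_right, wedge_self, wedge_anticomm θ (d 0 (ofFun f)), map_neg, map_add, map_zero]
  push_cast
  module

theorem dFun_ofFun (f g : C^∞⟮𝓘(ℝ, E), M; ℝ⟯) :
    dFun f 0 (ofFun g) = funSMul f (d 0 (ofFun g)) := by
  rw [dFun_apply, Nat.cast_zero, zero_smul, sub_zero]

theorem dTwist_funSMul (f : C^∞⟮𝓘(ℝ, E), M; ℝ⟯) (θ : DiffForm E M 1)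
    (g : C^∞⟮𝓘(ℝ, E), M; ℝ⟯) (φ : DiffForm E M r) :
    dTwist f θ r (funSMul g φ) =
      wedge (dFun f 0 (ofFun g)) φ + funSMul g (dTwist f θ r φ) := by
  rw [dFun_ofFun, wedge_funSMul_left]
  simp only [dTwist_apply, map_sub, map_smul, d_funSMul, wedge_funSMul_right, map_add,
    funSMul_comm g f]
  module

theorem pullback_dFun (g : C^∞⟮𝓘(ℝ, E), N; 𝓘(ℝ, E), M⟯) (f : C^∞⟮𝓘(ℝ, E), M; ℝ⟯)
    (φ : DiffForm E M r) :
    pullback g (dFun f r φ) = dFun (f.comp g) r (pullback g φ) := by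
  simp only [dFun_apply, map_sub, map_smul, pullback_funSMul, pullback_d, pullback_wedge,
    pullback_ofFun]

end DiffForm

section CoordinateIdentity

variable {g : N → M} {x : N}

theorem rep_pullbackFun_eventuallyEq_of_coord_eq_id (hg : ContMDiff 𝓘(ℝ, E) 𝓘(ℝ, E) ∞ g)
    (h : (fun z => extChartAt 𝓘(ℝ, E) (g x) (g ((extChartAt 𝓘(ℝ, E) x).symm z)))
      =ᶠ[𝓝 (extChartAt 𝓘(ℝ, E) x x)] id) (s : ∀ x : M, AltFiber E M r x) :
    rep x (pullbackFun g s) =ᶠ[𝓝 (extChartAt 𝓘(ℝ, E) x x)] rep (g x) s := by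
  have hrep := rep_pullback_eventually hg s x (g x) (mem_extChartAt_target x)
    (by rw [extChartAt_to_inv]; exact mem_extChartAt_source _)
  refine hrep.trans ?_
  filter_upwards [h.eventuallyEq_nhds] with z hz
  rw [hz.fderiv_eq, fderiv_id, show extChartAt 𝓘(ℝ, E) (g x) _ = z from hz.self_of_nhds]
  rfl

theorem pullbackFun_apply_of_coord_eq_id (hg : ContMDiff 𝓘(ℝ, E) 𝓘(ℝ, E) ∞ g)
    (h : (fun z => extChartAt 𝓘(ℝ, E) (g x) (g ((extChartAt 𝓘(ℝ, E) x).symm z)))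
      =ᶠ[𝓝 (extChartAt 𝓘(ℝ, E) x x)] id) (s : ∀ x : M, AltFiber E M r x) :
    pullbackFun g s x = s (g x) := by
  have hx : extChartAt 𝓘(ℝ, E) (g x) (g x) = extChartAt 𝓘(ℝ, E) x x := by
    have hself := h.self_of_nhds
    simp only [extChartAt_to_inv] at hself
    exact hself
  have hrep := (rep_pullbackFun_eventuallyEq_of_coord_eq_id hg h s).self_of_nhds
  rw [← hx, rep_extChartAt_self, hx] at hrep
  exact (rep_extChartAt_self _ x).symm.trans hrep

end CoordinateIdentity

omit [IsManifold 𝓘(ℝ, E) ∞ M] in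
theorem extChartAt_opens_symm_eventuallyEq_id (U : Opens M) (x : U) :
    (fun z => extChartAt 𝓘(ℝ, E) x.1 ((extChartAt 𝓘(ℝ, E) x).symm z).1)
      =ᶠ[𝓝 (extChartAt 𝓘(ℝ, E) x x)] id := by
  filter_upwards [target_nhds (mem_extChartAt_target (I := 𝓘(ℝ, E)) x)] with z hz
  exact (extChartAt 𝓘(ℝ, E) x).right_inv hz

theorem pullbackFun_val_apply (U : Opens M) (s : ∀ x : M, AltFiber E M r x) (x : U) :
    pullbackFun (Subtype.val : U → M) s x = s x.1 :=
  pullbackFun_apply_of_coord_eq_id contMDiff_subtype_val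
    (extChartAt_opens_symm_eventuallyEq_id U x) s

theorem resForm_apply (U : Opens M) (φ : DiffForm E M r) (x : U) : resForm U φ x = φ x.1 :=
  pullbackFun_val_apply U φ x

theorem pullback_inclLE_apply {U V : Opens M} (h : U ≤ V) (φ : DiffForm E V r) (x : U) :
    DiffForm.pullback (inclLE h) φ x = φ (Opens.inclusion h x) :=
  pullbackFun_apply_of_coord_eq_id (contMDiff_inclusion h)
    (extChartAt_opens_symm_eventuallyEq_id U x) φ

/-- Smoothness at the point `x` of a section of the bundle of alternating maps; the pointwise
version of `IsSmoothForm`. -/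
def IsSmoothFormAt (s : ∀ x : M, AltFiber E M r x) (x : M) : Prop :=
  ContMDiffAt 𝓘(ℝ, E) (𝓘(ℝ, E).prod 𝓘(ℝ, E [⋀^Fin r]→L[ℝ] ℝ)) ∞
    (fun x => Bundle.TotalSpace.mk' (E [⋀^Fin r]→L[ℝ] ℝ) x (s x)) x

theorem isSmoothFormAt_pullbackFun_val_iff {U : Opens M} {s : ∀ x : M, AltFiber E M r x} {x : U} :
    IsSmoothFormAt (pullbackFun (Subtype.val : U → M) s) x ↔ IsSmoothFormAt s x.1 := by
  have h := rep_pullbackFun_eventuallyEq_of_coord_eq_id contMDiff_subtype_val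
    (extChartAt_opens_symm_eventuallyEq_id U x) s
  rw [IsSmoothFormAt, IsSmoothFormAt, contMDiffAt_form_iff, contMDiffAt_form_iff]
  exact ⟨fun hx => hx.congr_of_eventuallyEq h.symm, fun hx => hx.congr_of_eventuallyEq h⟩

theorem isSmoothFormAt_of_eq_on_opens {W : Opens M} {s : ∀ x : M, AltFiber E M r x}
    (φ : DiffForm E W r) (h : ∀ y : W, s y.1 = φ y) {x : M} (hx : x ∈ W) :
    IsSmoothFormAt s x := by
  have hs : pullbackFun (Subtype.val : W → M) s = φ :=
    funext fun y => (pullbackFun_val_apply W s y).trans (h y)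
  refine (isSmoothFormAt_pullbackFun_val_iff (x := ⟨x, hx⟩)).1 ?_
  rw [hs]
  exact φ.contMDiff _

section Gluing

variable {U V : Opens M}

theorem mem_or_mem_of_sup_eq_top (hUV : U ⊔ V = ⊤) (x : M) : x ∈ U ∨ x ∈ V := by
  rw [← Opens.mem_sup, hUV]
  exact Opens.mem_top x

theorem eq_of_resForm_eq (hUV : U ⊔ V = ⊤) {φ ψ : DiffForm E M r}
    (hU : resForm U φ = resForm U ψ) (hV : resForm V φ = resForm V ψ) : φ = ψ := by
  refine ContMDiffSection.ext fun x => ?_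
  rcases mem_or_mem_of_sup_eq_top hUV x with hx | hx
  · rw [← resForm_apply U φ ⟨x, hx⟩, hU, resForm_apply]
  · rw [← resForm_apply V φ ⟨x, hx⟩, hV, resForm_apply]

theorem exists_resForm_eq (hUV : U ⊔ V = ⊤) (a : DiffForm E U r) (b : DiffForm E V r)
    (h : DiffForm.pullback (inclLE (inf_le_left : U ⊓ V ≤ U)) a =
      DiffForm.pullback (inclLE (inf_le_right : U ⊓ V ≤ V)) b) :
    ∃ φ : DiffForm E M r, resForm U φ = a ∧ resForm V φ = b := by
  classical
  let s : ∀ x : M, AltFiber E M r x := fun x =>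
    if hx : x ∈ U then (show E [⋀^Fin r]→L[ℝ] ℝ from a ⟨x, hx⟩)
    else if hx : x ∈ V then (show E [⋀^Fin r]→L[ℝ] ℝ from b ⟨x, hx⟩) else 0
  have hsU : ∀ y : U, s y.1 = a y := fun y => dif_pos y.2
  have hsV : ∀ y : V, s y.1 = b y := by
    intro y
    by_cases hy : y.1 ∈ U
    · have hab := congrArg (fun φ : DiffForm E ↥(U ⊓ V) r => φ ⟨y.1, hy, y.2⟩) h
      simp only [pullback_inclLE_apply] at hab
      exact (hsU ⟨y.1, hy⟩).trans hab
    · exact (dif_neg hy).trans (dif_pos y.2)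
  have hs : IsSmoothForm s := fun x =>
    (mem_or_mem_of_sup_eq_top hUV x).elim (isSmoothFormAt_of_eq_on_opens a hsU)
      (isSmoothFormAt_of_eq_on_opens b hsV)
  exact ⟨⟨s, hs⟩, ContMDiffSection.ext fun y => (resForm_apply U _ y).trans (hsU y),
    ContMDiffSection.ext fun y => (resForm_apply V _ y).trans (hsV y)⟩

theorem exists_pullback_inclLE_eq_funSMul {W X : Opens M} (h : W ≤ X) {g : C^∞⟮𝓘(ℝ, E), M; ℝ⟯}
    (hg : ∀ x ∈ X, x ∈ tsupport g → x ∈ W) (σ : DiffForm E W r) :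
    ∃ a : DiffForm E X r, DiffForm.pullback (inclLE h) a = DiffForm.funSMul (resFun W g) σ ∧
      ∀ x : X, x.1 ∉ W → ∀ᶠ y in 𝓝 x, a y = 0 := by
  classical
  let s : ∀ x : M, AltFiber E M r x := fun x =>
    if hx : x ∈ W then g x • (show E [⋀^Fin r]→L[ℝ] ℝ from σ ⟨x, hx⟩) else 0
  let T : Opens M := ⟨(tsupport g)ᶜ, (isClosed_tsupport g).isOpen_compl⟩
  have hsW : ∀ y : W, s y.1 = DiffForm.funSMul (resFun W g) σ y := fun y => dif_pos y.2
  have hsT : ∀ y : T, s y.1 = (0 : DiffForm E T r) y := by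
    intro y
    by_cases hy : y.1 ∈ W
    · refine (dif_pos hy).trans ?_
      rw [image_eq_zero_of_notMem_tsupport y.2]
      exact zero_smul ℝ (show E [⋀^Fin r]→L[ℝ] ℝ from σ ⟨y, hy⟩)
    · exact dif_neg hy
  have hs : IsSmoothForm (pullbackFun (Subtype.val : X → M) s) := fun x =>
    isSmoothFormAt_pullbackFun_val_iff.2 <| by
      by_cases hx : x.1 ∈ tsupport g
      · exact isSmoothFormAt_of_eq_on_opens _ hsW (hg x.1 x.2 hx)
      · exact isSmoothFormAt_of_eq_on_opens _ hsT hx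
  refine ⟨⟨_, hs⟩, ContMDiffSection.ext fun y => ?_, fun x hx => ?_⟩
  · exact (pullback_inclLE_apply h _ y).trans ((pullbackFun_val_apply X s _).trans (hsW y))
  · filter_upwards [continuous_subtype_val.continuousAt.preimage_mem_nhds
      (T.2.mem_nhds fun hT => hx (hg x.1 x.2 hT))] with y hy
    exact (pullbackFun_val_apply X s y).trans (hsT ⟨y.1, hy⟩)

end Gluing

section Restriction

variable (f : C^∞⟮𝓘(ℝ, E), M; ℝ⟯) (θ : DiffForm E M 1)

theorem resForm_dTwist (U : Opens M) (φ : DiffForm E M r) :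
    resForm U (DiffForm.dTwist f θ r φ) =
      DiffForm.dTwist (resFun U f) (resForm U θ) r (resForm U φ) :=
  DiffForm.pullback_dTwist (incl U) f θ φ

theorem pullback_inclLE_dTwist {W U : Opens M} (h : W ≤ U) (φ : DiffForm E U r) :
    DiffForm.pullback (inclLE h) (DiffForm.dTwist (resFun U f) (resForm U θ) r φ) =
      DiffForm.dTwist (resFun W f) (resForm W θ) r (DiffForm.pullback (inclLE h) φ) := by
  rw [DiffForm.pullback_dTwist, ← resForm_le h θ]
  rfl

theorem dTwist_apply_eq_zero_of_eventually_eq_zero {φ : DiffForm E M r} {x : M}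
    (h : ∀ᶠ y in 𝓝 x, φ y = 0) : DiffForm.dTwist f θ r φ x = 0 := by
  let T : Opens M := ⟨interior {y | φ y = 0}, isOpen_interior⟩
  have hT : resForm T φ = 0 := ContMDiffSection.ext fun y =>
    (resForm_apply T φ y).trans (interior_subset (s := {y | φ y = 0}) y.2)
  have hd : resForm T (DiffForm.dTwist f θ r φ) = 0 := by rw [resForm_dTwist, hT, map_zero]
  let x' : T := ⟨x, mem_interior_iff_mem_nhds.2 h⟩
  exact (resForm_apply T _ x').symm.trans (congrArg (fun ψ : DiffForm E T (r + 1) => ψ x') hd)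

variable {θ} in
theorem d_resForm_eq_zero (U : Opens M) (hθ : DiffForm.d 1 θ = 0) :
    DiffForm.d 1 (resForm U θ) = 0 := by
  rw [resForm, ← DiffForm.pullback_d, hθ, map_zero]

end Restriction

namespace DiffForm

/-- `α : Ωʳ(M) → Ωʳ(U) ⊕ Ωʳ(V)`, `φ ↦ (φ|_U, φ|_V)`, which induces `alphaStar`. -/
def alpha (U V : Opens M) (r : ℕ) : DiffForm E M r →ₗ[ℝ] DiffForm E U r × DiffForm E V r :=
  (resForm U).prod (resForm V)

/-- `β : Ωʳ(U) ⊕ Ωʳ(V) → Ωʳ(U ∩ V)`, `(φ, ψ) ↦ φ|_{U∩V} - ψ|_{U∩V}`, which induces `betaStar`. -/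
def beta (U V : Opens M) (r : ℕ) :
    DiffForm E U r × DiffForm E V r →ₗ[ℝ] DiffForm E ↥(U ⊓ V) r :=
  (pullback (inclLE inf_le_left)).comp (LinearMap.fst ℝ (DiffForm E U r) (DiffForm E V r)) -
    (pullback (inclLE inf_le_right)).comp (LinearMap.snd ℝ (DiffForm E U r) (DiffForm E V r))

variable {U V : Opens M}

theorem beta_apply (c : DiffForm E U r × DiffForm E V r) :
    beta U V r c = pullback (inclLE inf_le_left) c.1 - pullback (inclLE inf_le_right) c.2 :=
  rfl

theorem exact_alpha_beta (hUV : U ⊔ V = ⊤) (r : ℕ) :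
    Function.Exact (alpha U V r : DiffForm E M r →ₗ[ℝ] _) (beta U V r) := by
  rintro ⟨a, b⟩
  rw [beta_apply, sub_eq_zero]
  constructor
  · intro h
    obtain ⟨φ, hU, hV⟩ := exists_resForm_eq hUV a b h
    exact ⟨φ, Prod.ext hU hV⟩
  · rintro ⟨φ, hφ⟩
    rw [← hφ]
    exact (resForm_le inf_le_left φ).symm.trans (resForm_le inf_le_right φ)

variable (f : C^∞⟮𝓘(ℝ, E), M; ℝ⟯) (θ : DiffForm E M 1)

theorem beta_dTwist (c : DiffForm E U r × DiffForm E V r) :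
    beta U V (r + 1)
        (dTwist (resFun U f) (resForm U θ) r c.1, dTwist (resFun V f) (resForm V θ) r c.2) =
      dTwist (resFun (U ⊓ V) f) (resForm (U ⊓ V) θ) r (beta U V r c) := by
  rw [beta_apply, beta_apply, map_sub, pullback_inclLE_dTwist, pullback_inclLE_dTwist]

end DiffForm

namespace Cohomology

variable (f : C^∞⟮𝓘(ℝ, E), M; ℝ⟯) (θ : DiffForm E M 1)

theorem mk_surjective (r : ℕ) : Function.Surjective (mk f θ r) :=
  Submodule.mkQ_surjective _

theorem mk_zero_injective : Function.Injective (mk f θ 0) := by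
  refine LinearMap.ker_eq_bot.1 ((Submodule.ker_mkQ _).trans ?_)
  exact LinearMap.ker_eq_bot.2 Subtype.val_injective

end Cohomology

/-- Forms modulo `d_{f,θ}`-exact forms, `Ωʳ(M) / d_{f,θ} Ωʳ⁻¹(M)`. The cohomology is the kernel of
the map induced by `d_{f,θ}` from here to the closed `(r+1)`-forms, and in the next degree it is the
cokernel of this map, so that the snake lemma applies. -/
abbrev FormsModExact (f : C^∞⟮𝓘(ℝ, E), M; ℝ⟯) (θ : DiffForm E M 1) (r : ℕ) : Type _ :=
  DiffForm E M r ⧸ exactForms f θ r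

namespace FormsModExact

variable {f : C^∞⟮𝓘(ℝ, E), M; ℝ⟯} {θ : DiffForm E M 1}

variable (f) in
/-- The map `Ωʳ(M) / d_{f,θ} Ωʳ⁻¹(M) → ker d_{f,θ}` induced by `d_{f,θ}`. -/
def dTwist (hθ : DiffForm.d 1 θ = 0) (r : ℕ) : FormsModExact f θ r →ₗ[ℝ] closedForms f θ (r + 1) :=
  (exactForms f θ r).liftQ
    ((DiffForm.dTwist f θ r).codRestrict (closedForms f θ (r + 1)) fun φ =>
      DiffForm.dTwist_dTwist f hθ φ) <| by
    cases r with
    | zero => exact bot_le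
    | succ r =>
      rintro _ ⟨φ, rfl⟩
      exact Subtype.ext (DiffForm.dTwist_dTwist f hθ φ)

variable (f θ) in
/-- The inclusion of the cohomology into the forms modulo exact forms. -/
def ofCohomology (r : ℕ) : Cohomology f θ r →ₗ[ℝ] FormsModExact f θ r :=
  Submodule.mapQ _ _ (closedForms f θ r).subtype le_rfl

variable (f θ) in
theorem ofCohomology_injective (r : ℕ) : Function.Injective (ofCohomology f θ r) := by
  refine (injective_iff_map_eq_zero _).2 fun x hx => ?_
  obtain ⟨φ, rfl⟩ := Cohomology.mk_surjective f θ r x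
  exact (Submodule.Quotient.mk_eq_zero _).2
    ((Submodule.Quotient.mk_eq_zero (exactForms f θ r)).1 hx)

theorem exact_ofCohomology_dTwist (hθ : DiffForm.d 1 θ = 0) (r : ℕ) :
    Function.Exact (ofCohomology f θ r) (dTwist f hθ r) := by
  intro x
  obtain ⟨φ, rfl⟩ := Submodule.mkQ_surjective _ x
  constructor
  · intro h
    exact ⟨Cohomology.mk f θ r ⟨φ, congrArg Subtype.val h⟩, rfl⟩
  · rintro ⟨y, hy⟩
    obtain ⟨ψ, rfl⟩ := Cohomology.mk_surjective f θ r y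
    rw [← hy]
    exact Subtype.ext ψ.2

theorem exact_dTwist_mk (hθ : DiffForm.d 1 θ = 0) (r : ℕ) :
    Function.Exact (dTwist f hθ r) (Cohomology.mk f θ (r + 1)) := by
  rintro ψ
  rw [Cohomology.mk, Submodule.mkQ_apply, Submodule.Quotient.mk_eq_zero]
  constructor
  · rintro ⟨φ, hφ⟩
    exact ⟨Submodule.Quotient.mk φ, Subtype.ext hφ⟩
  · rintro ⟨x, rfl⟩
    obtain ⟨φ, rfl⟩ := Submodule.mkQ_surjective _ x
    exact ⟨φ, rfl⟩

/-- Pullback by `g` of forms modulo exact forms. -/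
def pullback (g : C^∞⟮𝓘(ℝ, E), N; 𝓘(ℝ, E), M⟯) {f' : C^∞⟮𝓘(ℝ, E), N; ℝ⟯} {θ' : DiffForm E N 1}
    (hf : f' = f.comp g) (hθ : θ' = DiffForm.pullback g θ) (r : ℕ) :
    FormsModExact f θ r →ₗ[ℝ] FormsModExact f' θ' r :=
  Submodule.mapQ _ _ (DiffForm.pullback g) fun φ hφ => by
    subst hf hθ
    exact pullback_mem_exactForms g f θ r φ hφ

end FormsModExact

section Algebra

variable {R : Type*} [CommRing R] {K₁ K₂ K₃ M₁ M₂ M₃ N₁ N₂ : Type*}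
  [AddCommGroup K₁] [Module R K₁] [AddCommGroup K₂] [Module R K₂] [AddCommGroup K₃] [Module R K₃]
  [AddCommGroup M₁] [Module R M₁] [AddCommGroup M₂] [Module R M₂] [AddCommGroup M₃] [Module R M₃]
  [AddCommGroup N₁] [Module R N₁] [AddCommGroup N₂] [Module R N₂]

theorem exact_prodMap {f₁ : K₁ →ₗ[R] M₁} {g₁ : M₁ →ₗ[R] N₁} {f₂ : K₂ →ₗ[R] M₂} {g₂ : M₂ →ₗ[R] N₂}
    (h₁ : Function.Exact f₁ g₁) (h₂ : Function.Exact f₂ g₂) :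
    Function.Exact (f₁.prodMap f₂) (g₁.prodMap g₂) := by
  refine LinearMap.exact_iff.2 ?_
  rw [LinearMap.ker_prodMap, LinearMap.range_prodMap, h₁.linearMap_ker_eq, h₂.linearMap_ker_eq]

theorem exact_of_exact_of_injective {k₁ : K₁ →ₗ[R] K₂} {k₂ : K₂ →ₗ[R] K₃} {f₁ : M₁ →ₗ[R] M₂}
    {f₂ : M₂ →ₗ[R] M₃} {g : N₁ →ₗ[R] N₂} {ι₁ : K₁ →ₗ[R] M₁} {ι₂ : K₂ →ₗ[R] M₂} {ι₃ : K₃ →ₗ[R] M₃}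
    {i₁ : M₁ →ₗ[R] N₁} {i₂ : M₂ →ₗ[R] N₂} (hf : Function.Exact f₁ f₂)
    (hι₁ : Function.Exact ι₁ i₁) (hι₂ : Function.Exact ι₂ i₂) (hι₂' : Function.Injective ι₂)
    (hι₃' : Function.Injective ι₃) (hg : Function.Injective g)
    (h₁ : f₁.comp ι₁ = ι₂.comp k₁) (h₂ : f₂.comp ι₂ = ι₃.comp k₂) (h₃ : g.comp i₁ = i₂.comp f₁) :
    Function.Exact k₁ k₂ := by
  intro x
  constructor
  · intro hx
    obtain ⟨y, hy⟩ := (hf (ι₂ x)).1 <| by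
      rw [← LinearMap.comp_apply, h₂, LinearMap.comp_apply, hx, map_zero]
    obtain ⟨z, rfl⟩ := (hι₁ y).1 <| hg <| by
      rw [← LinearMap.comp_apply, h₃, LinearMap.comp_apply, hy, hι₂.apply_apply_eq_zero, map_zero]
    exact ⟨z, hι₂' ((LinearMap.congr_fun h₁ z).symm.trans hy)⟩
  · rintro ⟨z, rfl⟩
    refine hι₃' ?_
    rw [map_zero, ← LinearMap.comp_apply ι₃, ← h₂, LinearMap.comp_apply, ← LinearMap.comp_apply ι₂,
      ← h₁, LinearMap.comp_apply, hf.apply_apply_eq_zero]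

end Algebra

section LongExactSequence

variable {f : C^∞⟮𝓘(ℝ, E), M; ℝ⟯} {θ : DiffForm E M 1} {U V : Opens M}

namespace closedForms

variable (f θ) in
/-- `DiffForm.alpha` on closed forms. -/
def alpha (U V : Opens M) (r : ℕ) :
    closedForms f θ r →ₗ[ℝ]
      closedForms (resFun U f) (resForm U θ) r × closedForms (resFun V f) (resForm V θ) r :=
  (pullback (incl U) rfl rfl r).prod (pullback (incl V) rfl rfl r)

variable (f θ) in
/-- `DiffForm.beta` on closed forms. -/
def beta (U V : Opens M) (r : ℕ) :
    closedForms (resFun U f) (resForm U θ) r × closedForms (resFun V f) (resForm V θ) r →ₗ[ℝ]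
      closedForms (resFun (U ⊓ V) f) (resForm (U ⊓ V) θ) r :=
  (pullback (inclLE inf_le_left) rfl (resForm_le inf_le_left θ) r).comp (LinearMap.fst ℝ
      (closedForms (resFun U f) (resForm U θ) r) (closedForms (resFun V f) (resForm V θ) r)) -
    (pullback (inclLE inf_le_right) rfl (resForm_le inf_le_right θ) r).comp (LinearMap.snd ℝ
      (closedForms (resFun U f) (resForm U θ) r) (closedForms (resFun V f) (resForm V θ) r))

variable (f θ) in
theorem alpha_injective (hUV : U ⊔ V = ⊤) (r : ℕ) : Function.Injective (alpha f θ U V r) :=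
  fun _ _ h => Subtype.ext <| eq_of_resForm_eq hUV
    (congrArg (fun c => c.1.1) h) (congrArg (fun c => c.2.1) h)

variable (f θ) in
theorem exact_alpha_beta (hUV : U ⊔ V = ⊤) (r : ℕ) :
    Function.Exact (alpha f θ U V r) (beta f θ U V r) := by
  rintro ⟨a, b⟩
  constructor
  · intro h
    obtain ⟨φ, hφ⟩ := (DiffForm.exact_alpha_beta hUV r (a.1, b.1)).1 (congrArg Subtype.val h)
    have hU : resForm U φ = a.1 := congrArg Prod.fst hφ
    have hV : resForm V φ = b.1 := congrArg Prod.snd hφ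
    have hclosed : DiffForm.dTwist f θ r φ = 0 := eq_of_resForm_eq hUV
      (by rw [resForm_dTwist, hU, map_zero]; exact a.2)
      (by rw [resForm_dTwist, hV, map_zero]; exact b.2)
    exact ⟨⟨φ, hclosed⟩, Prod.ext (Subtype.ext hU) (Subtype.ext hV)⟩
  · rintro ⟨φ, hφ⟩
    rw [← hφ]
    exact Subtype.ext ((DiffForm.exact_alpha_beta hUV r).apply_apply_eq_zero φ.1)

end closedForms

theorem exists_mem_exactForms_beta_eq
    (hs : ∀ r, Function.Surjective (DiffForm.beta (E := E) U V r)) {r : ℕ}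
    {τ : DiffForm E ↥(U ⊓ V) r} (hτ : τ ∈ exactForms (resFun (U ⊓ V) f) (resForm (U ⊓ V) θ) r) :
    ∃ c : DiffForm E U r × DiffForm E V r, c.1 ∈ exactForms (resFun U f) (resForm U θ) r ∧
      c.2 ∈ exactForms (resFun V f) (resForm V θ) r ∧ DiffForm.beta U V r c = τ := by
  cases r with
  | zero => exact ⟨0, rfl, rfl, (map_zero _).trans (Eq.symm hτ)⟩
  | succ r =>
    obtain ⟨σ, rfl⟩ := hτ
    obtain ⟨c, rfl⟩ := hs r σ
    exact ⟨_, ⟨c.1, rfl⟩, ⟨c.2, rfl⟩, DiffForm.beta_dTwist f θ c⟩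

namespace FormsModExact

variable {f' : C^∞⟮𝓘(ℝ, E), N; ℝ⟯} {θ' : DiffForm E N 1}

theorem pullback_ofCohomology (g : C^∞⟮𝓘(ℝ, E), N; 𝓘(ℝ, E), M⟯) (hf : f' = f.comp g)
    (hg : θ' = DiffForm.pullback g θ) (x : Cohomology f θ r) :
    pullback g hf hg r (ofCohomology f θ r x) =
      ofCohomology f' θ' r (Cohomology.pullback g hf hg r x) := by
  obtain ⟨φ, rfl⟩ := Cohomology.mk_surjective f θ r x
  rfl

theorem pullback_dTwist (g : C^∞⟮𝓘(ℝ, E), N; 𝓘(ℝ, E), M⟯) (hf : f' = f.comp g)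
    (hg : θ' = DiffForm.pullback g θ) (hθ : DiffForm.d 1 θ = 0) (hθ' : DiffForm.d 1 θ' = 0)
    (x : FormsModExact f θ r) :
    closedForms.pullback g hf hg (r + 1) (dTwist f hθ r x) =
      dTwist f' hθ' r (pullback g hf hg r x) := by
  subst hf hg
  obtain ⟨φ, rfl⟩ := Submodule.mkQ_surjective _ x
  exact Subtype.ext (DiffForm.pullback_dTwist g f θ φ)

variable (f θ) in
/-- `DiffForm.alpha` on forms modulo exact forms. -/
def alpha (U V : Opens M) (r : ℕ) :
    FormsModExact f θ r →ₗ[ℝ]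
      FormsModExact (resFun U f) (resForm U θ) r × FormsModExact (resFun V f) (resForm V θ) r :=
  (pullback (incl U) rfl rfl r).prod (pullback (incl V) rfl rfl r)

variable (f θ) in
/-- `DiffForm.beta` on forms modulo exact forms. -/
def beta (U V : Opens M) (r : ℕ) :
    FormsModExact (resFun U f) (resForm U θ) r × FormsModExact (resFun V f) (resForm V θ) r →ₗ[ℝ]
      FormsModExact (resFun (U ⊓ V) f) (resForm (U ⊓ V) θ) r :=
  (pullback (inclLE inf_le_left) rfl (resForm_le inf_le_left θ) r).comp (LinearMap.fst ℝ
      (FormsModExact (resFun U f) (resForm U θ) r) (FormsModExact (resFun V f) (resForm V θ) r)) -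
    (pullback (inclLE inf_le_right) rfl (resForm_le inf_le_right θ) r).comp (LinearMap.snd ℝ
      (FormsModExact (resFun U f) (resForm U θ) r) (FormsModExact (resFun V f) (resForm V θ) r))

variable (f θ) in
theorem beta_surjective {r : ℕ} (hs : Function.Surjective (DiffForm.beta (E := E) U V r)) :
    Function.Surjective (beta f θ U V r) := by
  intro x
  obtain ⟨σ, rfl⟩ := Submodule.mkQ_surjective _ x
  obtain ⟨c, rfl⟩ := hs σ
  exact ⟨(Submodule.Quotient.mk c.1, Submodule.Quotient.mk c.2), rfl⟩

variable (f θ) in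
theorem exact_alpha_beta (hUV : U ⊔ V = ⊤)
    (hs : ∀ r, Function.Surjective (DiffForm.beta (E := E) U V r)) (r : ℕ) :
    Function.Exact (alpha f θ U V r) (beta f θ U V r) := by
  rintro ⟨x, y⟩
  obtain ⟨a, rfl⟩ := Submodule.mkQ_surjective _ x
  obtain ⟨b, rfl⟩ := Submodule.mkQ_surjective _ y
  constructor
  · intro h
    have hab : DiffForm.beta U V r (a, b) ∈ exactForms (resFun (U ⊓ V) f) (resForm (U ⊓ V) θ) r :=
      (Submodule.Quotient.mk_eq_zero _).1 h
    obtain ⟨c, hcU, hcV, hc⟩ := exists_mem_exactForms_beta_eq hs hab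
    obtain ⟨φ, hφ⟩ := (DiffForm.exact_alpha_beta hUV r ((a, b) - c)).1 <| by
      rw [map_sub, hc, sub_self]
    have hU : a - resForm U φ = c.1 := sub_eq_iff_comm.1 (congrArg Prod.fst hφ).symm
    have hV : b - resForm V φ = c.2 := sub_eq_iff_comm.1 (congrArg Prod.snd hφ).symm
    exact ⟨Submodule.Quotient.mk φ,
      Prod.ext ((Submodule.Quotient.eq _).2 (hU ▸ hcU)).symm
        ((Submodule.Quotient.eq _).2 (hV ▸ hcV)).symm⟩
  · rintro ⟨z, hz⟩
    obtain ⟨φ, rfl⟩ := Submodule.mkQ_surjective _ z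
    rw [← hz]
    exact congrArg Submodule.Quotient.mk ((DiffForm.exact_alpha_beta hUV r).apply_apply_eq_zero φ)

variable (f θ) in
theorem alpha_comp_ofCohomology (U V : Opens M) (r : ℕ) :
    (alpha f θ U V r).comp (ofCohomology f θ r) =
      ((ofCohomology _ _ r).prodMap (ofCohomology _ _ r)).comp (alphaStar f θ U V r) :=
  LinearMap.ext fun x =>
    Prod.ext (pullback_ofCohomology (incl U) rfl rfl x) (pullback_ofCohomology (incl V) rfl rfl x)

variable (f θ) in
theorem beta_comp_ofCohomology (U V : Opens M) (r : ℕ) :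
    (beta f θ U V r).comp ((ofCohomology _ _ r).prodMap (ofCohomology _ _ r)) =
      (ofCohomology _ _ r).comp (betaStar f θ U V r) := by
  refine LinearMap.ext fun x => Eq.trans ?_
    (map_sub (ofCohomology (resFun (U ⊓ V) f) (resForm (U ⊓ V) θ) r) _ _).symm
  exact congrArg₂ (· - ·)
    (pullback_ofCohomology (inclLE inf_le_left) rfl (resForm_le inf_le_left θ) x.1)
    (pullback_ofCohomology (inclLE inf_le_right) rfl (resForm_le inf_le_right θ) x.2)

variable (f) in
theorem alpha_comp_dTwist (U V : Opens M) (hθ : DiffForm.d 1 θ = 0) (r : ℕ) :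
    (closedForms.alpha f θ U V (r + 1)).comp (dTwist f hθ r) =
      ((dTwist (resFun U f) (d_resForm_eq_zero U hθ) r).prodMap
        (dTwist (resFun V f) (d_resForm_eq_zero V hθ) r)).comp (alpha f θ U V r) :=
  LinearMap.ext fun x =>
    Prod.ext (pullback_dTwist (incl U) rfl rfl hθ (d_resForm_eq_zero U hθ) x)
      (pullback_dTwist (incl V) rfl rfl hθ (d_resForm_eq_zero V hθ) x)

variable (f) in
theorem beta_comp_dTwist (U V : Opens M) (hθ : DiffForm.d 1 θ = 0) (r : ℕ) :
    (closedForms.beta f θ U V (r + 1)).comp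
        ((dTwist (resFun U f) (d_resForm_eq_zero U hθ) r).prodMap
          (dTwist (resFun V f) (d_resForm_eq_zero V hθ) r)) =
      (dTwist (resFun (U ⊓ V) f) (d_resForm_eq_zero (U ⊓ V) hθ) r).comp (beta f θ U V r) := by
  have hW := d_resForm_eq_zero (U ⊓ V) hθ
  refine LinearMap.ext fun x => Eq.trans ?_ (map_sub (dTwist (resFun (U ⊓ V) f) hW r) _ _).symm
  exact congrArg₂ (· - ·)
    (pullback_dTwist (f' := resFun (U ⊓ V) f) (inclLE inf_le_left) rfl (resForm_le inf_le_left θ)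
      (d_resForm_eq_zero U hθ) hW x.1)
    (pullback_dTwist (f' := resFun (U ⊓ V) f) (inclLE inf_le_right) rfl (resForm_le inf_le_right θ)
      (d_resForm_eq_zero V hθ) hW x.2)

end FormsModExact

variable (f θ) in
theorem exact_alphaStar_betaStar (hθ : DiffForm.d 1 θ = 0) (hUV : U ⊔ V = ⊤)
    (hs : ∀ r, Function.Surjective (DiffForm.beta (E := E) U V r)) (r : ℕ) :
    Function.Exact (alphaStar f θ U V r) (betaStar f θ U V r) := by
  have hU := d_resForm_eq_zero U hθ
  have hV := d_resForm_eq_zero V hθ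
  exact exact_of_exact_of_injective (FormsModExact.exact_alpha_beta f θ hUV hs r)
    (FormsModExact.exact_ofCohomology_dTwist hθ r)
    (exact_prodMap (FormsModExact.exact_ofCohomology_dTwist hU r)
      (FormsModExact.exact_ofCohomology_dTwist hV r))
    ((FormsModExact.ofCohomology_injective _ _ r).prodMap
      (FormsModExact.ofCohomology_injective _ _ r))
    (FormsModExact.ofCohomology_injective _ _ r)
    (closedForms.alpha_injective f θ hUV (r + 1))
    (FormsModExact.alpha_comp_ofCohomology f θ U V r)
    (FormsModExact.beta_comp_ofCohomology f θ U V r)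
    (FormsModExact.alpha_comp_dTwist f U V hθ r)

variable (f θ) in
theorem alphaStar_zero_injective (hUV : U ⊔ V = ⊤) :
    Function.Injective (alphaStar f θ U V 0) := by
  refine Function.Injective.of_comp_right ?_ (Cohomology.mk_surjective f θ 0)
  exact ((Cohomology.mk_zero_injective _ _).prodMap (Cohomology.mk_zero_injective _ _)).comp
    (closedForms.alpha_injective f θ hUV 0)

/-- The connecting homomorphism `δ` of the Mayer-Vietoris sequence, obtained by applying the snake
lemma to the maps induced by `d_{f,θ}` from forms modulo exact forms to closed forms. -/
def connectingHom (f : C^∞⟮𝓘(ℝ, E), M; ℝ⟯) (hθ : DiffForm.d 1 θ = 0) (hUV : U ⊔ V = ⊤)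
    (hs : ∀ r, Function.Surjective (DiffForm.beta (E := E) U V r)) (r : ℕ) :
    Cohomology (resFun (U ⊓ V) f) (resForm (U ⊓ V) θ) r →ₗ[ℝ] Cohomology f θ (r + 1) :=
  SnakeLemma.δ' (FormsModExact.dTwist f hθ r)
    ((FormsModExact.dTwist (resFun U f) (d_resForm_eq_zero U hθ) r).prodMap
      (FormsModExact.dTwist (resFun V f) (d_resForm_eq_zero V hθ) r))
    (FormsModExact.dTwist (resFun (U ⊓ V) f) (d_resForm_eq_zero (U ⊓ V) hθ) r)
    (FormsModExact.alpha f θ U V r) (FormsModExact.beta f θ U V r)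
    (FormsModExact.exact_alpha_beta f θ hUV hs r)
    (closedForms.alpha f θ U V (r + 1)) (closedForms.beta f θ U V (r + 1))
    (closedForms.exact_alpha_beta f θ hUV (r + 1))
    (FormsModExact.alpha_comp_dTwist f U V hθ r)
    (FormsModExact.beta_comp_dTwist f U V hθ r)
    (FormsModExact.ofCohomology _ _ r)
    (FormsModExact.exact_ofCohomology_dTwist (d_resForm_eq_zero (U ⊓ V) hθ) r)
    (Cohomology.mk f θ (r + 1)) (FormsModExact.exact_dTwist_mk hθ r)
    (FormsModExact.beta_surjective f θ (hs r))
    (closedForms.alpha_injective f θ hUV (r + 1))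

section

variable (f) (hθ : DiffForm.d 1 θ = 0) (hUV : U ⊔ V = ⊤)
  (hs : ∀ r, Function.Surjective (DiffForm.beta (E := E) U V r))

theorem connectingHom_mk_eq {σ : closedForms (resFun (U ⊓ V) f) (resForm (U ⊓ V) θ) r}
    {c : DiffForm E U r × DiffForm E V r} (hc : DiffForm.beta U V r c = σ)
    {η : closedForms f θ (r + 1)}
    (hU : resForm U (η : DiffForm E M (r + 1)) =
      DiffForm.dTwist (resFun U f) (resForm U θ) r c.1)
    (hV : resForm V (η : DiffForm E M (r + 1)) =
      DiffForm.dTwist (resFun V f) (resForm V θ) r c.2) :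
    connectingHom f hθ hUV hs r (Cohomology.mk _ _ r σ) = Cohomology.mk f θ (r + 1) η :=
  SnakeLemma.δ'_eq (y := (Submodule.Quotient.mk c.1, Submodule.Quotient.mk c.2))
    (hy := congrArg Submodule.Quotient.mk hc)
    (hz := Prod.ext (Subtype.ext hU) (Subtype.ext hV)) ..

theorem exact_betaStar_connectingHom (r : ℕ) :
    Function.Exact (betaStar f θ U V r) (connectingHom f hθ hUV hs r) := by
  apply SnakeLemma.exact_δ'_right
  · exact exact_prodMap (FormsModExact.exact_ofCohomology_dTwist (d_resForm_eq_zero U hθ) r)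
      (FormsModExact.exact_ofCohomology_dTwist (d_resForm_eq_zero V hθ) r)
  · exact FormsModExact.beta_comp_ofCohomology f θ U V r
  · exact FormsModExact.ofCohomology_injective _ _ r

theorem exact_connectingHom_alphaStar (r : ℕ) :
    Function.Exact (connectingHom f hθ hUV hs r) (alphaStar f θ U V (r + 1)) := by
  apply SnakeLemma.exact_δ'_left
  · exact exact_prodMap (FormsModExact.exact_dTwist_mk (d_resForm_eq_zero U hθ) r)
      (FormsModExact.exact_dTwist_mk (d_resForm_eq_zero V hθ) r)
  · rfl
  · exact Cohomology.mk_surjective f θ (r + 1)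

end

end LongExactSequence

section PartitionOfUnity

variable {U V : Opens M} {ρ : SmoothPartitionOfUnity (Fin 2) 𝓘(ℝ, E) M Set.univ}

omit [IsManifold 𝓘(ℝ, E) ∞ M] in
theorem partition_add_eq_one (ρ : SmoothPartitionOfUnity (Fin 2) 𝓘(ℝ, E) M Set.univ) :
    ρ 0 + ρ 1 = ContMDiffMap.const 1 := by
  ext x
  have h := ρ.sum_eq_one (Set.mem_univ x)
  rwa [finsum_eq_sum_of_fintype, Fin.sum_univ_two] at h

omit [IsManifold 𝓘(ℝ, E) ∞ M] in
theorem sup_eq_top_of_isSubordinate (hρ : ρ.IsSubordinate ![(U : Set M), (V : Set M)]) :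
    U ⊔ V = ⊤ := by
  refine top_unique fun x _ => ?_
  obtain ⟨i, hi⟩ := ρ.exists_pos_of_mem (Set.mem_univ x)
  have hx : x ∈ tsupport (ρ i) := subset_tsupport _ hi.ne'
  fin_cases i
  exacts [Or.inl (hρ 0 hx), Or.inr (hρ 1 hx)]

theorem exists_isSubordinate_of_sup_eq_top [FiniteDimensional ℝ E] [T2Space M] [SigmaCompactSpace M]
    (hUV : U ⊔ V = ⊤) :
    ∃ ρ : SmoothPartitionOfUnity (Fin 2) 𝓘(ℝ, E) M Set.univ,
      ρ.IsSubordinate ![(U : Set M), (V : Set M)] :=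
  SmoothPartitionOfUnity.exists_isSubordinate 𝓘(ℝ, E) isClosed_univ _
    (Fin.forall_fin_two.2 ⟨U.2, V.2⟩) fun x _ => Set.mem_iUnion.2 <|
      Fin.exists_fin_two.2 (mem_or_mem_of_sup_eq_top hUV x)

theorem dFun_partition_zero (f : C^∞⟮𝓘(ℝ, E), M; ℝ⟯)
    (ρ : SmoothPartitionOfUnity (Fin 2) 𝓘(ℝ, E) M Set.univ) :
    DiffForm.dFun f 0 (DiffForm.ofFun (ρ 0)) = -DiffForm.dFun f 0 (DiffForm.ofFun (ρ 1)) := by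
  rw [eq_neg_iff_add_eq_zero, ← map_add, ← DiffForm.ofFun_add, partition_add_eq_one,
    DiffForm.dFun_ofFun, DiffForm.d_ofFun_const, map_zero]

theorem exists_beta_eq_of_isSubordinate (hρ : ρ.IsSubordinate ![(U : Set M), (V : Set M)])
    (σ : DiffForm E ↥(U ⊓ V) r) :
    ∃ c : DiffForm E U r × DiffForm E V r, DiffForm.beta U V r c = σ ∧
      DiffForm.pullback (inclLE inf_le_left) c.1 = DiffForm.funSMul (resFun (U ⊓ V) (ρ 1)) σ ∧
      (∀ x : U, x.1 ∉ U ⊓ V → ∀ᶠ y in 𝓝 x, c.1 y = 0) ∧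
      ∀ x : V, x.1 ∉ U ⊓ V → ∀ᶠ y in 𝓝 x, c.2 y = 0 := by
  obtain ⟨a, ha, ha₀⟩ := exists_pullback_inclLE_eq_funSMul inf_le_left
    (fun x hU hx => ⟨hU, hρ 1 hx⟩) σ
  obtain ⟨b, hb, hb₀⟩ := exists_pullback_inclLE_eq_funSMul inf_le_right
    (fun x hV hx => ⟨hρ 0 hx, hV⟩) σ
  refine ⟨(a, -b), ?_, ha, ha₀, fun x hx => ?_⟩
  · rw [DiffForm.beta_apply, map_neg, sub_neg_eq_add, ha, hb]
    refine ContMDiffSection.ext fun x => ?_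
    have hx : ρ 0 x.1 + ρ 1 x.1 = 1 := congrArg (fun g => g x.1) (partition_add_eq_one ρ)
    exact (add_smul (ρ 1 x.1) (ρ 0 x.1) (σ x)).symm.trans (by rw [add_comm, hx, one_smul])
  · filter_upwards [hb₀ x hx] with y hy
    exact (congrArg Neg.neg hy).trans neg_zero

theorem beta_surjective_of_isSubordinate (hρ : ρ.IsSubordinate ![(U : Set M), (V : Set M)])
    (r : ℕ) : Function.Surjective (DiffForm.beta (E := E) U V r) := fun σ =>
  (exists_beta_eq_of_isSubordinate hρ σ).imp fun _ hc => hc.1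

theorem exists_resForm_eq_dTwist {f : C^∞⟮𝓘(ℝ, E), M; ℝ⟯} {θ : DiffForm E M 1}
    (hθ : DiffForm.d 1 θ = 0) (hUV : U ⊔ V = ⊤) {c : DiffForm E U r × DiffForm E V r}
    (hc : DiffForm.beta U V r c ∈ closedForms (resFun (U ⊓ V) f) (resForm (U ⊓ V) θ) r) :
    ∃ η : closedForms f θ (r + 1),
      resForm U (η : DiffForm E M (r + 1)) = DiffForm.dTwist (resFun U f) (resForm U θ) r c.1 ∧
      resForm V (η : DiffForm E M (r + 1)) = DiffForm.dTwist (resFun V f) (resForm V θ) r c.2 := by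
  obtain ⟨η, hη⟩ := (closedForms.exact_alpha_beta f θ hUV (r + 1)
    (⟨_, DiffForm.dTwist_dTwist _ (d_resForm_eq_zero U hθ) c.1⟩,
      ⟨_, DiffForm.dTwist_dTwist _ (d_resForm_eq_zero V hθ) c.2⟩)).1
    (Subtype.ext ((DiffForm.beta_dTwist f θ c).trans hc))
  exact ⟨η, congrArg (fun p => p.1.1) hη, congrArg (fun p => p.2.1) hη⟩

theorem IsExtensionByZero.neg {W : Opens M} {τ : DiffForm E W r} {η : DiffForm E M r}
    (h : IsExtensionByZero τ η) : IsExtensionByZero (-τ) (-η) :=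
  ⟨(map_neg _ _).trans (congrArg _ h.1), fun x hx => (congrArg Neg.neg (h.2 x hx)).trans neg_zero⟩

theorem resForm_dFun_ofFun (f g : C^∞⟮𝓘(ℝ, E), M; ℝ⟯) (U : Opens M) :
    resForm U (DiffForm.dFun f 0 (DiffForm.ofFun g)) =
      DiffForm.dFun (resFun U f) 0 (DiffForm.ofFun (resFun U g)) := by
  rw [resForm, DiffForm.pullback_dFun, DiffForm.pullback_ofFun]
  rfl

theorem exists_isExtensionByZero_connectingHom (f : C^∞⟮𝓘(ℝ, E), M; ℝ⟯) {θ : DiffForm E M 1}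
    (hθ : DiffForm.d 1 θ = 0) (hUV : U ⊔ V = ⊤)
    (hs : ∀ r, Function.Surjective (DiffForm.beta (E := E) U V r))
    (hρ : ρ.IsSubordinate ![(U : Set M), (V : Set M)])
    (σ : closedForms (resFun (U ⊓ V) f) (resForm (U ⊓ V) θ) r) :
    ∃ η : closedForms f θ (r + 1),
      IsExtensionByZero
        (DiffForm.wedge (resForm (U ⊓ V) (DiffForm.dFun f 0 (DiffForm.ofFun (ρ 1))))
          (σ : DiffForm E ↥(U ⊓ V) r))
        (η : DiffForm E M (r + 1)) ∧
      connectingHom f hθ hUV hs r (Cohomology.mk _ _ r σ) = Cohomology.mk f θ (r + 1) η := by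
  obtain ⟨c, hc, hc₁, hcU, hcV⟩ := exists_beta_eq_of_isSubordinate hρ (σ : DiffForm E ↥(U ⊓ V) r)
  obtain ⟨η, hU, hV⟩ := exists_resForm_eq_dTwist hθ hUV (f := f) (hc ▸ σ.2)
  have hσ : DiffForm.dTwist (resFun (U ⊓ V) f) (resForm (U ⊓ V) θ) r
      (σ : DiffForm E ↥(U ⊓ V) r) = 0 := σ.2
  refine ⟨η, ⟨?_, fun x hx => ?_⟩, connectingHom_mk_eq f hθ hUV hs hc hU hV⟩
  · rw [resForm_le inf_le_left, hU, pullback_inclLE_dTwist, hc₁, DiffForm.dTwist_funSMul, hσ,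
      map_zero, add_zero, resForm_dFun_ofFun]
  · rcases mem_or_mem_of_sup_eq_top hUV x with h | h
    · rw [← resForm_apply U _ ⟨x, h⟩, hU]
      exact dTwist_apply_eq_zero_of_eventually_eq_zero _ _ (hcU ⟨x, h⟩ hx)
    · rw [← resForm_apply V _ ⟨x, h⟩, hV]
      exact dTwist_apply_eq_zero_of_eventually_eq_zero _ _ (hcV ⟨x, h⟩ hx)

end PartitionOfUnity

end LichCoh

end

theorem theorem2p1_general
    {E : Type*} [NormedAddCommGroup E] [NormedSpace ℝ E]
    {M : Type*} [TopologicalSpace M] [ChartedSpace E M] [IsManifold 𝓘(ℝ, E) ∞ M]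
    (f : C^∞⟮𝓘(ℝ, E), M; ℝ⟯) (θ : DiffForm E M 1) (hθ : DiffForm.d 1 θ = 0)
    (U V : TopologicalSpace.Opens M) (ρ₀ : SmoothPartitionOfUnity (Fin 2) 𝓘(ℝ, E) M Set.univ)
    (hρ₀ : ρ₀.IsSubordinate ![(U : Set M), (V : Set M)]) :
    ∃ δ : ∀ r : ℕ, Cohomology (resFun (U ⊓ V) f) (resForm (U ⊓ V) θ) r →ₗ[ℝ]
        Cohomology f θ (r + 1),
      Function.Injective (alphaStar f θ U V 0) ∧
      (∀ r : ℕ,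
        Function.Exact (alphaStar f θ U V r) (betaStar f θ U V r) ∧
        Function.Exact (betaStar f θ U V r) (δ r) ∧
        Function.Exact (δ r) (alphaStar f θ U V (r + 1))) ∧
      ∀ ρ : SmoothPartitionOfUnity (Fin 2) 𝓘(ℝ, E) M Set.univ,
        ρ.IsSubordinate ![(U : Set M), (V : Set M)] →
        ∀ (r : ℕ) (σ : closedForms (resFun (U ⊓ V) f) (resForm (U ⊓ V) θ) r),
          (∃ η : closedForms f θ (r + 1),
            IsExtensionByZero
              (DiffForm.wedge (resForm (U ⊓ V) (DiffForm.dFun f 0 (DiffForm.ofFun (ρ 1))))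
                (σ : DiffForm E ↥(U ⊓ V) r))
              (η : DiffForm E M (r + 1)) ∧
            δ r (Cohomology.mk _ _ r σ) = Cohomology.mk f θ (r + 1) η) ∧
          (∃ η : closedForms f θ (r + 1),
            IsExtensionByZero
              (DiffForm.wedge (resForm (U ⊓ V) (DiffForm.dFun f 0 (DiffForm.ofFun (ρ 0))))
                (σ : DiffForm E ↥(U ⊓ V) r))
              (η : DiffForm E M (r + 1)) ∧
            δ r (Cohomology.mk _ _ r σ) = -Cohomology.mk f θ (r + 1) η) := by
  have hUV : U ⊔ V = ⊤ := sup_eq_top_of_isSubordinate hρ₀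
  have hs : ∀ r, Function.Surjective (DiffForm.beta (E := E) U V r) :=
    beta_surjective_of_isSubordinate hρ₀
  refine ⟨connectingHom f hθ hUV hs, alphaStar_zero_injective f θ hUV, fun r =>
    ⟨exact_alphaStar_betaStar f θ hθ hUV hs r, exact_betaStar_connectingHom f hθ hUV hs r,
      exact_connectingHom_alphaStar f hθ hUV hs r⟩, fun ρ hρ r σ => ?_⟩
  obtain ⟨η, hη, hδ⟩ := exists_isExtensionByZero_connectingHom f hθ hUV hs hρ σ
  refine ⟨⟨η, hη, hδ⟩, -η, ?_, ?_⟩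
  · rw [dFun_partition_zero, map_neg, DiffForm.neg_wedge]
    exact hη.neg
  · rw [hδ, map_neg, neg_neg]

theorem theorem2p1
    {E : Type*} [NormedAddCommGroup E] [NormedSpace ℝ E] [FiniteDimensional ℝ E]
    {M : Type*} [TopologicalSpace M] [T2Space M] [SigmaCompactSpace M]
    [ChartedSpace E M] [IsManifold 𝓘(ℝ, E) ∞ M]
    (f : C^∞⟮𝓘(ℝ, E), M; ℝ⟯) (θ : DiffForm E M 1) (hθ : DiffForm.d 1 θ = 0)
    (U V : TopologicalSpace.Opens M) (hUV : U ⊔ V = ⊤) :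
    ∃ δ : ∀ r : ℕ, Cohomology (resFun (U ⊓ V) f) (resForm (U ⊓ V) θ) r →ₗ[ℝ]
        Cohomology f θ (r + 1),
      Function.Injective (alphaStar f θ U V 0) ∧
      (∀ r : ℕ,
        Function.Exact (alphaStar f θ U V r) (betaStar f θ U V r) ∧
        Function.Exact (betaStar f θ U V r) (δ r) ∧
        Function.Exact (δ r) (alphaStar f θ U V (r + 1))) ∧
      ∀ ρ : SmoothPartitionOfUnity (Fin 2) 𝓘(ℝ, E) M Set.univ,
        ρ.IsSubordinate ![(U : Set M), (V : Set M)] →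
        ∀ (r : ℕ) (σ : closedForms (resFun (U ⊓ V) f) (resForm (U ⊓ V) θ) r),
          (∃ η : closedForms f θ (r + 1),
            IsExtensionByZero
              (DiffForm.wedge (resForm (U ⊓ V) (DiffForm.dFun f 0 (DiffForm.ofFun (ρ 1))))
                (σ : DiffForm E ↥(U ⊓ V) r))
              (η : DiffForm E M (r + 1)) ∧
            δ r (Cohomology.mk _ _ r σ) = Cohomology.mk f θ (r + 1) η) ∧
          (∃ η : closedForms f θ (r + 1),
            IsExtensionByZero
              (DiffForm.wedge (resForm (U ⊓ V) (DiffForm.dFun f 0 (DiffForm.ofFun (ρ 0))))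
                (σ : DiffForm E ↥(U ⊓ V) r))
              (η : DiffForm E M (r + 1)) ∧
            δ r (Cohomology.mk _ _ r σ) = -Cohomology.mk f θ (r + 1) η) := by
  obtain ⟨ρ, hρ⟩ := exists_isSubordinate_of_sup_eq_top (E := E) hUV
  exact theorem2p1_general f θ hθ U V ρ hρ
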